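/- Partitions are weakly decreasing finite sequences of positive integers (the empty partition is included), and $s_\lambda=\sum_T x^T$ denotes the Schur function of $\lambda$, the sum over all semistandard Young tableaux $T$ of shape $\lambda$ (complex coefficients, infinitely many variables). For partitions $\mu,\nu$ the product has a unique expansion $s_\mu s_\nu=\sum_\lambda c^\lambda_{\mu,\nu}s_\lambda$ as a finite linear combination of Schur functions; the $c^\lambda_{\mu,\nu}$ are the Littlewood–Richardson coefficients. The code of a partition $\lambda$ is the doubly infinite sequence of letters U and R obtained by placing the Young diagram of $\lambda$, top and left aligned, in the fourth quadrant, and tracing up the negative $y$-axis to the bottom of the diagram, along its lower right edge, and then right along the positive $x$-axis; U stands for a unit step up and R for a unit step to the right. Let $u_i(\lambda)$ be the number of U's to the right of the $i$-th R from the left (the number of parts of size at least $i$), and let $r_i(\lambda)$ be the number of R's to the left of the $i$-th U from the right (so $r_i(\lambda)=\lambda_i$). **Theorem (Littlewood–Richardson rule in terms of codes).** Let $\mu,\nu$ be partitions and $l=u_1(\nu)$. Then $$s_\mu s_\nu=\sum_\lambda c^\lambda_{\mu,\nu}s_\lambda=\sum_{(\mu=\mu^0,\mu^1,\ldots,\mu^l)}s_{\mu^l},$$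 where the last sum is finite and runs over all sequences of partitions $\mu=\mu^0,\mu^1,\dots,\mu^l$ with the following properties. 1. For $1\le i\le l$, the code of $\mu^i$ is obtained from the code of $\mu^{i-1}$ as follows: starting with the U just left of the leftmost R in the code of $\mu^{i-1}$ and working to the right, move each U some number (possibly zero) of places to the right by switching UR to RU, with $r_i(\nu)$ switches in total. (So no U moves past the starting point of the next U.) 2. Let $k(i,j)$ be the number of switches made in step $i$ using the last $j$ U's, i.e. the $j$ rightmost ones; in particular $k(i,0)=0$. Then $k(i,j)\le k(i-1,j-1)$ for all $2\le i\le l$ and all $j\ge1$. Consequently, for every partition $\lambda$, $c^\lambda_{\mu,\nu}$ is the number of such sequences with $\mu^l=\lambda$. -/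

import Mathlib

/-! Partitions are Young diagrams (Mathlib's `YoungDiagram`, rows and columns numbered from `0`,
the empty partition included). -/

namespace CodeLR

/-- The two letters of a code: a unit step to the right, a unit step up. -/
inductive Letter where
  | R : Letter
  | U : Letter

/-- A doubly infinite sequence of letters. -/
abbrev Code := ℤ → Letter

open Classical in
/-- The code of a partition `lam`. Trace the boundary of the diagram (fourth quadrant, row `a`
between the heights `-(a+1)` and `-a`) from the negative `y`-axis to the positive `x`-axis. Every
unit step raises `x + y` by one, and the letter at place `p` is the step that starts on the line
`x + y = p`. The up steps are those at the right ends of the rows `a`, from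
`(rowLen a, -(a+1))` to `(rowLen a, -a)`; rows with `rowLen a = 0` give the steps along the
negative `y`-axis. All other steps go right. -/
noncomputable def code (lam : YoungDiagram) : Code := fun p =>
  if ∃ a : ℕ, p = (lam.rowLen a : ℤ) - (a + 1) then Letter.U else Letter.R

/-- The right steps of the path are those at the lower ends of the columns `b`, from
`(b, -colLen b)` to `(b + 1, -colLen b)`. -/
theorem code_eq_R_iff (lam : YoungDiagram) (p : ℤ) :
    code lam p = Letter.R ↔ ∃ b : ℕ, p = (b : ℤ) - lam.colLen b := by
  have key : ∀ a b : ℕ, a < lam.colLen b ↔ b < lam.rowLen a := fun a b => by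
    rw [← YoungDiagram.mem_iff_lt_colLen, YoungDiagram.mem_iff_lt_rowLen]
  have hR : code lam p = Letter.R ↔ ¬ ∃ a : ℕ, p = (lam.rowLen a : ℤ) - (a + 1) := by
    unfold code
    split_ifs with h
    · simp [h]
    · simp [h]
  rw [hR]
  constructor
  · intro h
    push Not at h
    have hex : ∃ a : ℕ, (lam.rowLen a : ℤ) - (a + 1) < p := by
      obtain ⟨N, hN⟩ : ∃ N : ℕ, (lam.rowLen 0 : ℤ) - p ≤ N :=
        ⟨_, Int.self_le_toNat _⟩
      refine ⟨N, ?_⟩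
      have h1 := lam.rowLen_anti 0 N (Nat.zero_le _)
      omega
    classical
    have ha := Nat.find_spec hex
    have hmin := fun a' => @Nat.find_min _ _ hex a'
    generalize Nat.find hex = a at ha hmin
    obtain ⟨b, hb⟩ := Int.eq_ofNat_of_zero_le (show 0 ≤ p + a by omega)
    refine ⟨b, ?_⟩
    have h2 : ¬ a < lam.colLen b := by rw [key]; omega
    have h3 : a ≤ lam.colLen b := by
      rcases Nat.eq_zero_or_pos a with h0 | h0
      · omega
      · have h4 := hmin (a - 1) (by omega)
        have h5 := h (a - 1)
        have h6 : a - 1 < lam.colLen b := by rw [key]; omega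
        omega
    omega
  · rintro ⟨b, hb⟩ ⟨a, ha⟩
    have := key a b
    omega

/-- The letter at place `p` is the `j`-th U from the right. -/
def IsUFromRight (c : Code) (j : ℕ) (p : ℤ) : Prop :=
  c p = Letter.U ∧ {q : ℤ | p ≤ q ∧ c q = Letter.U}.encard = (j : ℕ∞)

/-- The letter at place `p` is the `i`-th R from the left. -/
def IsRFromLeft (c : Code) (i : ℕ) (p : ℤ) : Prop :=
  c p = Letter.R ∧ {q : ℤ | q ≤ p ∧ c q = Letter.R}.encard = (i : ℕ∞)

/-- `u_i(lam)`: the number of U's in the code to the right of the `i`-th R from the left. -/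
noncomputable def u (lam : YoungDiagram) (i : ℕ) : ℕ :=
  {q : ℤ | code lam q = Letter.U ∧ ∃ p, IsRFromLeft (code lam) i p ∧ p < q}.ncard

/-- `r_i(lam)`: the number of R's in the code to the left of the `i`-th U from the right. -/
noncomputable def r (lam : YoungDiagram) (i : ℕ) : ℕ :=
  {q : ℤ | code lam q = Letter.R ∧ ∃ p, IsUFromRight (code lam) i p ∧ q < p}.ncard

/-- Put `RU` at the places `p`, `p + 1`. It is only used where `UR` stands there. -/
def switchUR (c : Code) (p : ℤ) : Code :=
  Function.update (Function.update c p Letter.R) (p + 1) Letter.U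

/-- `MoveU c p d c'`: the U at place `p` of `c` is moved to the right by `d` successive switches
of `UR` to `RU`, and the result is `c'`. -/
inductive MoveU : Code → ℤ → ℕ → Code → Prop where
  | zero (c : Code) (p : ℤ) : c p = Letter.U → MoveU c p 0 c
  | succ (c c' : Code) (p : ℤ) (d : ℕ) : c p = Letter.U → c (p + 1) = Letter.R →
      MoveU (switchUR c p) (p + 1) d c' → MoveU c p (d + 1) c'

/-- `Sweep m N c c'`: the last `N` U's of `c` are moved one after the other, from the left to the
right, the `j`-th U from the right by `m j` switches, and the result is `c'`. When a U is moved,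
the next U to its right has not moved yet, and a U is only switched with R's, so that no U moves
past the starting point of the next U. -/
inductive Sweep (m : ℕ → ℕ) : ℕ → Code → Code → Prop where
  | zero (c : Code) : Sweep m 0 c c
  | succ (N : ℕ) (c c₁ c' : Code) (p : ℤ) : IsUFromRight c (N + 1) p →
      MoveU c p (m (N + 1)) c₁ → Sweep m N c₁ c' → Sweep m (N + 1) c c'

/-- `IsStep al be n m`: the code of `be` is obtained from the code of `al` by `n` switches in one
sweep that starts with the U just left of the leftmost R (there are `u_1(al)` U's to the right of
that R, so this is the U with number `u_1(al) + 1` from the right); `m j` is the number of switches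
made using the `j`-th U from the right (no other U moves, and there is no U with number `0`). -/
def IsStep (al be : YoungDiagram) (n : ℕ) (m : ℕ → ℕ) : Prop :=
  Sweep m (u al 1 + 1) (code al) (code be) ∧
    (∀ j, j ∉ Finset.Icc 1 (u al 1 + 1) → m j = 0) ∧
    ∑ j ∈ Finset.Icc 1 (u al 1 + 1), m j = n

/-- `k(i,j)`: the number of switches made in step `i` using the last `j` U's, when `m i t` is the
number of switches made in step `i` using the `t`-th U from the right. -/
def k (m : ℕ → ℕ → ℕ) (i j : ℕ) : ℕ := ∑ t ∈ Finset.Icc 1 j, m i t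

/-- The sequences `mu = mu^0, mu^1, …, mu^l`, `l = u_1(nu)`, of the rule. The numbers `m i t` of
switches are determined by the sequence. Steps are numbered from `1`, so `k(i-1, j-1)` is there for
`i ≥ 2` and `j ≥ 1`. -/
def IsLRSequence (mu nu : YoungDiagram) (q : Fin (u nu 1 + 1) → YoungDiagram) : Prop :=
  q 0 = mu ∧ ∃ m : ℕ → ℕ → ℕ,
    (∀ i : Fin (u nu 1), IsStep (q i.castSucc) (q i.succ) (r nu (i + 1)) (m (i + 1))) ∧
    ∀ i j : ℕ, 2 ≤ i → i ≤ u nu 1 → 1 ≤ j → k m i j ≤ k m (i - 1) (j - 1)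

/-- The exponent of the monomial `x^T` of a semistandard tableau `T`. -/
noncomputable def content {lam : YoungDiagram} (T : SemistandardYoungTableau lam) : ℕ →₀ ℕ :=
  ∑ b ∈ lam.cells, Finsupp.single (T b.1 b.2) 1

/-- The Schur function `s_lam = ∑_T x^T`, the sum over all semistandard tableaux `T` of shape
`lam`, in the variables `x_0, x_1, x_2, …`: the coefficient at `x^d` is the (finite) number of
tableaux with content `d`. -/
noncomputable def schur (lam : YoungDiagram) : MvPowerSeries ℕ ℂ := fun d =>
  (Nat.card {T : SemistandardYoungTableau lam // content T = d} : ℂ)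

/-- `f = ∑_lam c_lam s_lam`, a finite linear combination of Schur functions. For
`f = s_mu s_nu` the numbers `c_lam` are the Littlewood–Richardson coefficients. -/
def IsSchurExpansion (f : MvPowerSeries ℕ ℂ) (c : YoungDiagram →₀ ℂ) : Prop :=
  f = c.sum fun lam a => a • schur lam

end CodeLR

open CodeLR

/-!
A semistandard tableau `T` of shape `nu` is the Gelfand–Tsetlin pattern that counts the entries
`< s` in its row `i`. The Bender–Knuth involutions make `s_nu` symmetric, so for the alternants
`a_α` in finitely many variables `s_nu * a_{mu + ρ} = ∑_T a_{mu + content T + ρ}`. Read the rows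
of `T` from the top down and each row from right to left. If at some point `mu` plus the content
read so far is no longer a partition, some part `t + 1` has just become larger by one than part
`t`; exchanging the numbers of letters `t` and `t + 1` in the unread part of `T` is an involution
that reverses the sign of the alternant. Only the tableaux that never fail remain, and dividing
by `a_ρ` gives a sum of Schur polynomials.

In terms of patterns, the remaining tableaux are the sequences of the rule: row `i` of `T` says
how many switches step `i` makes with each U, reading along the rows produces the partitions
`mu^i`, the condition that no U passes the starting point of the next is dominance, and the
inequality `k(i, j) ≤ k(i - 1, j - 1)` is the interlacing that makes the columns of `T` strictly
increasing.
-/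

namespace CodeLR

open Finset

open Classical in
/-- The code whose U's are at the values of `f`; row `a` of a diagram is matched with `f a`, so
`f` is strictly decreasing wherever it is used. -/
noncomputable def codeOf (f : ℕ → ℤ) : Code := fun p =>
  if p ∈ Set.range f then Letter.U else Letter.R

theorem codeOf_eq_U_iff {f : ℕ → ℤ} {p : ℤ} : codeOf f p = Letter.U ↔ p ∈ Set.range f := by
  unfold codeOf
  split_ifs with h <;> simp only [h]

theorem codeOf_eq_R_iff {f : ℕ → ℤ} {p : ℤ} : codeOf f p = Letter.R ↔ p ∉ Set.range f := by
  unfold codeOf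
  split_ifs with h <;> simp only [h, not_true_eq_false, not_false_eq_true]

theorem codeOf_apply (f : ℕ → ℤ) (a : ℕ) : codeOf f (f a) = Letter.U :=
  codeOf_eq_U_iff.mpr ⟨a, rfl⟩

theorem code_ext {c c' : Code} (h : ∀ p, c p = Letter.U ↔ c' p = Letter.U) : c = c' := by
  funext p
  have hp := h p
  cases hc : c p <;> cases hc' : c' p <;> simp_all only [reduceCtorEq, iff_true, iff_false]

theorem codeOf_inj {f f' : ℕ → ℤ} (hf : StrictAnti f) (hf' : StrictAnti f') :
    codeOf f = codeOf f' ↔ f = f' := by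
  refine ⟨fun h => ?_, fun h => h ▸ rfl⟩
  have hrange : Set.range f = Set.range f' := Set.ext fun p => by
    rw [← codeOf_eq_U_iff, h, codeOf_eq_U_iff]
  exact (StrictMono.range_inj hf.dual_right hf'.dual_right).mp hrange

theorem update_codeOf {f : ℕ → ℤ} (hf : f.Injective) (N : ℕ) (q : ℤ) :
    Function.update (Function.update (codeOf f) (f N) Letter.R) q Letter.U =
      codeOf (Function.update f N q) := by
  refine code_ext fun p => ?_
  rw [codeOf_eq_U_iff]
  obtain rfl | hq := eq_or_ne p q
  · simpa only [Function.update_self, true_iff] using ⟨N, Function.update_self ..⟩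
  have hrange : p ∈ Set.range (Function.update f N q) ↔ ∃ a ≠ N, f a = p := by
    refine exists_congr fun a => ?_
    obtain rfl | ha := eq_or_ne a N
    · simp only [Function.update_self, hq.symm, ne_eq, not_true_eq_false, false_and]
    · simp only [Function.update_of_ne ha, ne_eq, ha, not_false_eq_true, true_and]
  rw [hrange, Function.update_of_ne hq]
  obtain rfl | hN := eq_or_ne p (f N)
  · simp only [Function.update_self, reduceCtorEq, hf.eq_iff, ne_eq, not_and_self, exists_false]
  · rw [Function.update_of_ne hN, codeOf_eq_U_iff]
    exact exists_congr fun a => (and_iff_right_of_imp fun h ha => hN (by rw [← h, ha])).symm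

theorem strictAnti_update_add {f : ℕ → ℤ} (hf : StrictAnti f) {N d : ℕ}
    (h : ∀ a < N, f N + d < f a) : StrictAnti (Function.update f N (f N + d)) := by
  intro a b hab
  have hfab := hf hab
  obtain rfl | ha := eq_or_ne a N
  · rw [Function.update_self, Function.update_of_ne hab.ne']
    omega
  obtain rfl | hb := eq_or_ne b N
  · rw [Function.update_self, Function.update_of_ne ha]
    exact h a hab
  · rwa [Function.update_of_ne ha, Function.update_of_ne hb]

theorem encard_image_Iic {f : ℕ → ℤ} (hf : f.Injective) (a : ℕ) :
    (f '' Set.Iic a).encard = (a + 1 : ℕ) := by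
  rw [hf.encard_image, ← coe_Iic, Set.encard_coe_eq_coe_finsetCard, Nat.card_Iic]

theorem isUFromRight_codeOf_iff {f : ℕ → ℤ} (hf : StrictAnti f) {i : ℕ} {p : ℤ} :
    IsUFromRight (codeOf f) (i + 1) p ↔ p = f i := by
  have hset : ∀ a, {q | f a ≤ q ∧ codeOf f q = Letter.U} = f '' Set.Iic a := fun a => by
    ext q
    simp only [codeOf_eq_U_iff, Set.mem_ofPred_eq, Set.mem_range, Set.mem_image, Set.mem_Iic]
    constructor
    · rintro ⟨h, b, rfl⟩
      exact ⟨b, hf.le_iff_ge.mp h, rfl⟩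
    · rintro ⟨b, hb, rfl⟩
      exact ⟨hf.le_iff_ge.mpr hb, b, rfl⟩
  constructor
  · rintro ⟨hp, hcard⟩
    obtain ⟨a, rfl⟩ := codeOf_eq_U_iff.mp hp
    rw [hset, encard_image_Iic hf.injective, Nat.cast_inj, Nat.succ_inj] at hcard
    rw [hcard]
  · rintro rfl
    exact ⟨codeOf_apply f i, by rw [hset, encard_image_Iic hf.injective]⟩

theorem moveU_succ_iff {c c' : Code} {p : ℤ} {d : ℕ} :
    MoveU c p (d + 1) c' ↔
      c p = Letter.U ∧ c (p + 1) = Letter.R ∧ MoveU (switchUR c p) (p + 1) d c' :=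
  ⟨fun h => by cases h with | succ _ _ _ _ hU hR h => exact ⟨hU, hR, h⟩,
    fun ⟨hU, hR, h⟩ => MoveU.succ _ _ _ _ hU hR h⟩

theorem moveU_iff {c c' : Code} {p : ℤ} {d : ℕ} :
    MoveU c p d c' ↔ c p = Letter.U ∧ (∀ e < d, c (p + (e + 1 : ℕ)) = Letter.R) ∧
      c' = Function.update (Function.update c p Letter.R) (p + d) Letter.U := by
  induction d generalizing c p with
  | zero =>
    simp only [not_lt_zero, IsEmpty.forall_iff, implies_true, Nat.cast_zero, add_zero,
      Function.update_idem, true_and]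
    constructor
    · rintro ⟨⟩
      rename_i hU
      exact ⟨hU, by rw [← hU, Function.update_eq_self]⟩
    · rintro ⟨hU, rfl⟩
      rw [← hU, Function.update_eq_self]
      exact MoveU.zero c p hU
  | succ d ih =>
    rw [moveU_succ_iff, ih, Nat.forall_lt_succ_left', zero_add, Nat.cast_one, and_assoc]
    refine and_congr_right fun _ => and_congr_right fun hR => ?_
    have hself : switchUR c p (p + 1) = Letter.U := Function.update_self ..
    have hne : ∀ e : ℕ, switchUR c p (p + 1 + (e + 1 : ℕ)) = c (p + (e + 1 + 1 : ℕ)) := fun e => by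
      rw [switchUR, Function.update_of_ne (by omega), Function.update_of_ne (by omega)]
      congr 1
      push_cast
      ring
    have hupdate : Function.update (switchUR c p) (p + 1) Letter.R =
        Function.update c p Letter.R := by
      rw [switchUR, Function.update_idem, Function.update_eq_self_iff,
        Function.update_of_ne (by omega), hR]
    simp only [hself, hne, hupdate, true_and]
    rw [Nat.cast_add_one, add_assoc, add_comm (1 : ℤ)]

theorem moveU_codeOf_iff {f : ℕ → ℤ} (hf : StrictAnti f) {N d : ℕ} {c' : Code} :
    MoveU (codeOf f) (f N) d c' ↔
      (∀ a < N, f N + d < f a) ∧ c' = codeOf (Function.update f N (f N + d)) := by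
  rw [moveU_iff, update_codeOf hf.injective, and_iff_right (codeOf_apply f N)]
  refine and_congr_left fun _ => ?_
  simp only [codeOf_eq_R_iff, Set.mem_range, not_exists]
  constructor
  · intro h a ha
    have hlt := hf ha
    have hfree := h (f a - f N - 1).toNat
    by_contra! hle
    exact hfree (by omega) a (by omega)
  · intro h e he a ha
    have := h a (hf.lt_iff_gt.mp (by omega))
    omega

theorem sweep_succ_codeOf_iff {m : ℕ → ℕ} {f : ℕ → ℤ} (hf : StrictAnti f) {N : ℕ} {c' : Code} :
    Sweep m (N + 1) (codeOf f) c' ↔ (∀ a < N, f N + m (N + 1) < f a) ∧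
      Sweep m N (codeOf (Function.update f N (f N + m (N + 1)))) c' := by
  constructor
  · rintro (_ | ⟨_, _, c₁, _, p, hU, hmove, hsweep⟩)
    obtain rfl := (isUFromRight_codeOf_iff hf).mp hU
    obtain ⟨h, rfl⟩ := (moveU_codeOf_iff hf).mp hmove
    exact ⟨h, hsweep⟩
  · rintro ⟨h, hsweep⟩
    exact Sweep.succ N _ _ _ _ ((isUFromRight_codeOf_iff hf).mpr rfl)
      ((moveU_codeOf_iff hf).mpr ⟨h, rfl⟩) hsweep

theorem sweep_codeOf_iff {m : ℕ → ℕ} {f : ℕ → ℤ} (hf : StrictAnti f) {N : ℕ} {c' : Code} :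
    Sweep m N (codeOf f) c' ↔ (∀ b < N, ∀ a < b, f b + m (b + 1) < f a) ∧
      c' = codeOf fun a => if a < N then f a + m (a + 1) else f a := by
  induction N generalizing f with
  | zero =>
    simp only [not_lt_zero, IsEmpty.forall_iff, implies_true, if_false, true_and]
    exact ⟨fun h => by cases h; rfl, fun h => h ▸ Sweep.zero _⟩
  | succ N ih =>
    rw [sweep_succ_codeOf_iff hf, Nat.forall_lt_succ_right,
      and_comm (a := ∀ b < N, ∀ a < b, _), and_assoc]
    refine and_congr_right fun h => ?_
    rw [ih (strictAnti_update_add hf h)]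
    refine and_congr (forall₄_congr fun b hb a ha => ?_) ?_
    · rw [Function.update_of_ne hb.ne, Function.update_of_ne (ha.trans hb).ne]
    · refine Eq.congr_right (congrArg codeOf (funext fun a => ?_))
      obtain rfl | ha := eq_or_ne a N
      · simp only [lt_irrefl, if_false, Function.update_self, Nat.lt_succ_self, if_true]
      · simp only [Function.update_of_ne ha, Nat.lt_succ_iff_lt_or_eq, ha, or_false]

theorem sweep_codeOf_iff_of_eq_zero {m : ℕ → ℕ} {f : ℕ → ℤ} (hf : StrictAnti f) {N : ℕ}
    (hm : ∀ a, N ≤ a → m (a + 1) = 0) {c' : Code} :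
    Sweep m N (codeOf f) c' ↔ (∀ b, ∀ a < b, f b + m (b + 1) < f a) ∧
      c' = codeOf fun a => f a + m (a + 1) := by
  rw [sweep_codeOf_iff hf]
  refine and_congr ⟨fun h b a hab => ?_, fun h b _ => h b⟩
    (Eq.congr_right (congrArg codeOf (funext fun a => ?_)))
  · obtain hb | hb := lt_or_ge b N
    · exact h b hb a hab
    · simpa only [hm b hb, Nat.cast_zero, add_zero] using hf hab
  · split_ifs with ha
    · rfl
    · rw [hm a (not_lt.mp ha), Nat.cast_zero, add_zero]

/-- The place in the code of the U at the right end of row `a`. -/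
def upPlace (lam : YoungDiagram) (a : ℕ) : ℤ := (lam.rowLen a : ℤ) - (a + 1)

/-- The place in the code of the R at the lower end of column `b`. -/
def downPlace (lam : YoungDiagram) (b : ℕ) : ℤ := (b : ℤ) - lam.colLen b

theorem code_eq_codeOf_upPlace (lam : YoungDiagram) : code lam = codeOf (upPlace lam) := by
  classical exact funext fun _ => if_congr (exists_congr fun _ => eq_comm) rfl rfl

theorem code_eq_U_iff_mem_range_upPlace {lam : YoungDiagram} {p : ℤ} :
    code lam p = Letter.U ↔ p ∈ Set.range (upPlace lam) := by
  rw [code_eq_codeOf_upPlace, codeOf_eq_U_iff]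

theorem code_eq_R_iff_mem_range_downPlace {lam : YoungDiagram} {p : ℤ} :
    code lam p = Letter.R ↔ p ∈ Set.range (downPlace lam) := by
  simp only [code_eq_R_iff, downPlace, Set.mem_range, @eq_comm ℤ p]

theorem strictAnti_upPlace (lam : YoungDiagram) : StrictAnti (upPlace lam) := by
  intro a b hab
  have := lam.rowLen_anti a b hab.le
  simp only [upPlace]
  omega

theorem strictMono_downPlace (lam : YoungDiagram) : StrictMono (downPlace lam) := by
  intro a b hab
  have := lam.colLen_anti a b hab.le
  simp only [downPlace]
  omega

theorem lt_colLen_iff_lt_rowLen {lam : YoungDiagram} {a b : ℕ} :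
    a < lam.colLen b ↔ b < lam.rowLen a := by
  rw [← YoungDiagram.mem_iff_lt_colLen, YoungDiagram.mem_iff_lt_rowLen]

theorem rowLen_eq_zero_iff {lam : YoungDiagram} {a : ℕ} :
    lam.rowLen a = 0 ↔ lam.colLen 0 ≤ a := by
  rw [← not_lt, lt_colLen_iff_lt_rowLen, Nat.pos_iff_ne_zero, not_not]

theorem downPlace_lt_upPlace_iff {lam : YoungDiagram} {a b : ℕ} :
    downPlace lam b < upPlace lam a ↔ b < lam.rowLen a := by
  have := lt_colLen_iff_lt_rowLen (lam := lam) (a := a) (b := b)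
  simp only [upPlace, downPlace]
  omega

theorem isRFromLeft_code_iff {lam : YoungDiagram} {i : ℕ} {p : ℤ} :
    IsRFromLeft (code lam) (i + 1) p ↔ p = downPlace lam i := by
  have hmono := strictMono_downPlace lam
  have hset : ∀ b, {q | q ≤ downPlace lam b ∧ code lam q = Letter.R} =
      downPlace lam '' Set.Iic b := fun b => by
    ext q
    simp only [code_eq_R_iff_mem_range_downPlace, Set.mem_ofPred_eq, Set.mem_range, Set.mem_image,
      Set.mem_Iic]
    constructor
    · rintro ⟨h, a, rfl⟩
      exact ⟨a, hmono.le_iff_le.mp h, rfl⟩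
    · rintro ⟨a, ha, rfl⟩
      exact ⟨hmono.le_iff_le.mpr ha, a, rfl⟩
  constructor
  · rintro ⟨hp, hcard⟩
    obtain ⟨b, rfl⟩ := code_eq_R_iff_mem_range_downPlace.mp hp
    rw [hset, encard_image_Iic hmono.injective, Nat.cast_inj, Nat.succ_inj] at hcard
    rw [hcard]
  · rintro rfl
    exact ⟨code_eq_R_iff_mem_range_downPlace.mpr ⟨i, rfl⟩,
      by rw [hset, encard_image_Iic hmono.injective]⟩

theorem u_succ (lam : YoungDiagram) (i : ℕ) : u lam (i + 1) = lam.colLen i := by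
  have hset : {q | code lam q = Letter.U ∧ ∃ p, IsRFromLeft (code lam) (i + 1) p ∧ p < q} =
      upPlace lam '' (range (lam.colLen i) : Set ℕ) := by
    ext q
    simp only [isRFromLeft_code_iff, exists_eq_left, code_eq_U_iff_mem_range_upPlace,
      Set.mem_ofPred_eq, Set.mem_range, Set.mem_image, mem_coe, Finset.mem_range]
    constructor
    · rintro ⟨⟨a, rfl⟩, h⟩
      exact ⟨a, lt_colLen_iff_lt_rowLen.mpr (downPlace_lt_upPlace_iff.mp h), rfl⟩
    · rintro ⟨a, ha, rfl⟩
      exact ⟨⟨a, rfl⟩, downPlace_lt_upPlace_iff.mpr (lt_colLen_iff_lt_rowLen.mp ha)⟩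
  rw [u, hset, Set.ncard_image_of_injective _ (strictAnti_upPlace lam).injective,
    Set.ncard_coe_finset, card_range]

theorem isUFromRight_code_iff {lam : YoungDiagram} {i : ℕ} {p : ℤ} :
    IsUFromRight (code lam) (i + 1) p ↔ p = upPlace lam i := by
  rw [code_eq_codeOf_upPlace, isUFromRight_codeOf_iff (strictAnti_upPlace lam)]

theorem r_succ (lam : YoungDiagram) (i : ℕ) : r lam (i + 1) = lam.rowLen i := by
  have hset : {q | code lam q = Letter.R ∧ ∃ p, IsUFromRight (code lam) (i + 1) p ∧ q < p} =
      downPlace lam '' (range (lam.rowLen i) : Set ℕ) := by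
    ext q
    simp only [isUFromRight_code_iff, exists_eq_left, code_eq_R_iff_mem_range_downPlace,
      Set.mem_ofPred_eq, Set.mem_range, Set.mem_image, mem_coe, Finset.mem_range]
    constructor
    · rintro ⟨⟨b, rfl⟩, h⟩
      exact ⟨b, downPlace_lt_upPlace_iff.mp h, rfl⟩
    · rintro ⟨b, hb, rfl⟩
      exact ⟨⟨b, rfl⟩, downPlace_lt_upPlace_iff.mpr hb⟩
  rw [r, hset, Set.ncard_image_of_injective _ (strictMono_downPlace lam).injective,
    Set.ncard_coe_finset, card_range]

/-- `be / al` is a horizontal strip: `be` contains `al`, with at most one more cell in each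
column. -/
def IsHorizontalStrip (al be : YoungDiagram) : Prop :=
  ∀ a, al.rowLen a ≤ be.rowLen a ∧ be.rowLen (a + 1) ≤ al.rowLen a

theorem sweep_code_iff {al be : YoungDiagram} {m : ℕ → ℕ} {N : ℕ}
    (hm : ∀ a, N ≤ a → m (a + 1) = 0) :
    Sweep m N (code al) (code be) ↔
      IsHorizontalStrip al be ∧ ∀ a, be.rowLen a = al.rowLen a + m (a + 1) := by
  rw [code_eq_codeOf_upPlace, code_eq_codeOf_upPlace,
    sweep_codeOf_iff_of_eq_zero (strictAnti_upPlace al) hm]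
  constructor
  · rintro ⟨hlt, hcode⟩
    have hanti : StrictAnti fun a => upPlace al a + m (a + 1) := fun a b hab =>
      (hlt b a hab).trans_le (by simp only; omega)
    have hrow : ∀ a, be.rowLen a = al.rowLen a + m (a + 1) := fun a => by
      have := congrFun ((codeOf_inj (strictAnti_upPlace be) hanti).mp hcode) a
      simp only [upPlace] at this
      omega
    refine ⟨fun a => ⟨by rw [hrow a]; omega, ?_⟩, hrow⟩
    have := hlt (a + 1) a a.lt_succ_self
    have := hrow (a + 1)
    simp only [upPlace] at *
    omega
  · rintro ⟨hstrip, hrow⟩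
    refine ⟨fun b a hab => ?_, congrArg codeOf (funext fun a => ?_)⟩
    · obtain ⟨b, rfl⟩ := Nat.exists_eq_add_of_lt hab
      have := (hstrip (a + b)).2
      have := al.rowLen_anti a (a + b) (by omega)
      have := hrow (a + b + 1)
      simp only [upPlace]
      omega
    · have := hrow a
      simp only [upPlace]
      omega

theorem isStep_iff {al be : YoungDiagram} {n s : ℕ} {m : ℕ → ℕ} (hs : al.colLen 0 < s) :
    IsStep al be n m ↔ IsHorizontalStrip al be ∧ m 0 = 0 ∧
      (∀ a, be.rowLen a = al.rowLen a + m (a + 1)) ∧ ∑ a ∈ range s, m (a + 1) = n := by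
  have hsum : (∀ a, al.colLen 0 + 1 ≤ a → m (a + 1) = 0) →
      ∑ j ∈ Icc 1 (al.colLen 0 + 1), m j = ∑ a ∈ range s, m (a + 1) := fun hm => by
    rw [← Ico_add_one_right_eq_Icc, sum_Ico_eq_sum_range, Nat.add_sub_cancel]
    simp only [add_comm 1]
    exact sum_subset (range_mono hs) fun a _ ha => hm a (by simpa using ha)
  rw [IsStep, u_succ]
  constructor
  · rintro ⟨hsweep, hm, hn⟩
    have hm' : ∀ a, al.colLen 0 + 1 ≤ a → m (a + 1) = 0 := fun a ha =>
      hm _ fun h => by have := mem_Icc.mp h; omega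
    obtain ⟨hstrip, hrow⟩ := (sweep_code_iff hm').mp hsweep
    exact ⟨hstrip, hm 0 fun h => by simp at h, hrow, hsum hm' ▸ hn⟩
  · rintro ⟨hstrip, hm0, hrow, hn⟩
    have hm : ∀ a, al.colLen 0 + 1 ≤ a → m (a + 1) = 0 := fun a ha => by
      obtain ⟨a, rfl⟩ := Nat.exists_eq_add_of_lt ha
      have := (hstrip (al.colLen 0 + a)).2
      have := hrow (al.colLen 0 + a + 1)
      have := rowLen_eq_zero_iff.mpr (Nat.le_add_right (al.colLen 0) a)
      lia
    refine ⟨(sweep_code_iff hm).mpr ⟨hstrip, hrow⟩, fun j hj => ?_, (hsum hm).trans hn⟩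
    cases j with
    | zero => exact hm0
    | succ a => exact hm a (by by_contra h; exact hj (mem_Icc.mpr ⟨by omega, by omega⟩))

/-- Gelfand–Tsetlin patterns with `n` levels and top row `nu`: `g s i` is the number of entries
`< s` in row `i` of the corresponding semistandard tableau of shape `nu` with entries `< n`. All
levels from `n` on are `nu`, so that no bounds on the indices are needed. -/
structure IsGTPattern (n : ℕ) (nu : ℕ → ℕ) (g : ℕ → ℕ → ℕ) : Prop where
  zero : ∀ i, g 0 i = 0
  le_succ : ∀ s i, g s i ≤ g (s + 1) i
  succ_succ_le : ∀ s i, g (s + 1) (i + 1) ≤ g s i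
  eq_top : ∀ s, n ≤ s → ∀ i, g s i = nu i

section GTPattern

variable {n : ℕ} {nu : ℕ → ℕ} {g : ℕ → ℕ → ℕ}

namespace IsGTPattern

theorem monotone (h : IsGTPattern n nu g) (i : ℕ) : Monotone fun s => g s i :=
  monotone_nat_of_le_succ fun s => h.le_succ s i

theorem antitone (h : IsGTPattern n nu g) (s : ℕ) : Antitone (g s) :=
  antitone_nat_of_succ_le fun i => (h.le_succ s (i + 1)).trans (h.succ_succ_le s i)

theorem eq_zero (h : IsGTPattern n nu g) : ∀ {s i : ℕ}, s ≤ i → g s i = 0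
  | 0, i, _ => h.zero i
  | s + 1, i + 1, hs =>
    Nat.le_zero.mp ((h.succ_succ_le s i).trans (h.eq_zero (Nat.succ_le_succ_iff.mp hs)).le)

theorem le_top (h : IsGTPattern n nu g) (s i : ℕ) : g s i ≤ nu i :=
  (h.monotone i (le_max_left s n)).trans (h.eq_top _ (le_max_right s n) i).le

theorem antitone_top (h : IsGTPattern n nu g) : Antitone nu :=
  antitone_nat_of_succ_le fun i => by
    simpa only [h.eq_top (n + 1) n.le_succ, h.eq_top n le_rfl] using h.succ_succ_le n i

theorem top_eq_zero (h : IsGTPattern n nu g) {i : ℕ} (hi : n ≤ i) : nu i = 0 := by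
  rw [← h.eq_top i hi, h.eq_zero le_rfl]

theorem eq_zero_of_le (h : IsGTPattern n nu g) (s : ℕ) {i : ℕ} (hi : n ≤ i) : g s i = 0 :=
  Nat.le_zero.mp (h.top_eq_zero hi ▸ h.le_top s i)

end IsGTPattern

theorem finite_setOf_isGTPattern (n : ℕ) (nu : ℕ → ℕ) : {g | IsGTPattern n nu g}.Finite := by
  let F : {g // IsGTPattern n nu g} → Fin n → Fin n → Fin (nu 0 + 1) := fun g s i =>
    ⟨g.1 s i, Nat.lt_succ_of_le ((g.2.le_top s i).trans (g.2.antitone_top (Nat.zero_le _)))⟩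
  refine Set.finite_coe_iff.mp (Finite.of_injective F fun g g' hg => ?_)
  ext s i
  obtain hs | hs := le_or_gt n s
  · rw [g.2.eq_top s hs, g'.2.eq_top s hs]
  obtain hi | hi := le_or_gt n i
  · rw [g.2.eq_zero_of_le s hi, g'.2.eq_zero_of_le s hi]
  · exact congrArg Fin.val (congrFun (congrFun hg ⟨s, hs⟩) ⟨i, hi⟩)

/-- The Gelfand–Tsetlin patterns with `n` levels and top row `nu`, as a finite set to sum over. -/
noncomputable def gtPatterns (n : ℕ) (nu : ℕ → ℕ) : Finset (ℕ → ℕ → ℕ) :=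
  (finite_setOf_isGTPattern n nu).toFinset

theorem mem_gtPatterns : g ∈ gtPatterns n nu ↔ IsGTPattern n nu g :=
  Set.Finite.mem_toFinset _

/-- The weight of a pattern: the number of entries `t` in the first `i` rows. -/
def weight (g : ℕ → ℕ → ℕ) (i t : ℕ) : ℕ := ∑ j ∈ range i, (g (t + 1) j - g t j)

theorem weight_zero (g : ℕ → ℕ → ℕ) (t : ℕ) : weight g 0 t = 0 := rfl

theorem weight_succ (g : ℕ → ℕ → ℕ) (i t : ℕ) :
    weight g (i + 1) t = weight g i t + (g (t + 1) i - g t i) :=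
  sum_range_succ _ _

theorem weight_congr {g g' : ℕ → ℕ → ℕ} {i t : ℕ}
    (h : ∀ j < i, g (t + 1) j = g' (t + 1) j ∧ g t j = g' t j) : weight g i t = weight g' i t :=
  sum_congr rfl fun j hj => by rw [(h j (mem_range.mp hj)).1, (h j (mem_range.mp hj)).2]

namespace IsGTPattern

theorem weight_eq_zero (h : IsGTPattern n nu g) (i : ℕ) {t : ℕ} (ht : n ≤ t) :
    weight g i t = 0 :=
  sum_eq_zero fun j _ => by rw [h.eq_top (t + 1) (by omega), h.eq_top t ht, Nat.sub_self]

theorem weight_add_weight_succ (h : IsGTPattern n nu g) (i t : ℕ) :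
    weight g i t + weight g i (t + 1) = ∑ j ∈ range i, (g (t + 2) j - g t j) := by
  rw [weight, weight, ← sum_add_distrib]
  refine sum_congr rfl fun j _ => ?_
  have := h.le_succ t j
  have := h.le_succ (t + 1) j
  lia

end IsGTPattern

end GTPattern

/-- The least value allowed for `g (t + 1) i` by the neighbouring levels `t` and `t + 2`. -/
def lowerBound (g : ℕ → ℕ → ℕ) (t i : ℕ) : ℕ := max (g t i) (g (t + 2) (i + 1))

/-- The greatest value allowed for `g (t + 1) i` by the neighbouring levels `t` and `t + 2`. -/
def upperBound (g : ℕ → ℕ → ℕ) (t : ℕ) : ℕ → ℕ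
  | 0 => g (t + 2) 0
  | i + 1 => min (g (t + 2) (i + 1)) (g t i)

theorem upperBound_le (g : ℕ → ℕ → ℕ) (t : ℕ) : ∀ i, upperBound g t i ≤ g (t + 2) i
  | 0 => le_rfl
  | _ + 1 => min_le_left _ _

theorem upperBound_succ_add_lowerBound (g : ℕ → ℕ → ℕ) (t i : ℕ) :
    upperBound g t (i + 1) + lowerBound g t i = g (t + 2) (i + 1) + g t i := by
  rw [upperBound, lowerBound, max_comm, min_add_max]

theorem IsGTPattern.lowerBound_le {n : ℕ} {nu : ℕ → ℕ} {g : ℕ → ℕ → ℕ} (h : IsGTPattern n nu g)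
    (t i : ℕ) : lowerBound g t i ≤ g (t + 1) i :=
  max_le (h.le_succ t i) (h.succ_succ_le (t + 1) i)

theorem IsGTPattern.le_upperBound {n : ℕ} {nu : ℕ → ℕ} {g : ℕ → ℕ → ℕ} (h : IsGTPattern n nu g)
    (t : ℕ) : ∀ i, g (t + 1) i ≤ upperBound g t i
  | 0 => h.le_succ (t + 1) 0
  | i + 1 => le_min (h.le_succ (t + 1) (i + 1)) (h.succ_succ_le t i)

/-- The Bender–Knuth involution that exchanges the numbers of letters `t` and `t + 1`, restricted
to the first `c` columns of row `i₀` and all rows below. -/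
def toggle (t i₀ c : ℕ) (g : ℕ → ℕ → ℕ) : ℕ → ℕ → ℕ := fun s i =>
  if s = t + 1 ∧ i₀ ≤ i then
    lowerBound g t i + (if i = i₀ then c else upperBound g t i) - g s i
  else g s i

section Toggle

variable {n : ℕ} {nu : ℕ → ℕ} {g : ℕ → ℕ → ℕ} {t i₀ c : ℕ}

theorem toggle_of_ne {s : ℕ} (hs : s ≠ t + 1) (i : ℕ) : toggle t i₀ c g s i = g s i :=
  if_neg fun h => hs h.1

theorem toggle_of_lt (s : ℕ) {i : ℕ} (hi : i < i₀) : toggle t i₀ c g s i = g s i :=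
  if_neg fun h => hi.not_ge h.2

theorem toggle_self : toggle t i₀ c g (t + 1) i₀ = lowerBound g t i₀ + c - g (t + 1) i₀ := by
  simp only [toggle, le_refl, and_self, if_true]

theorem toggle_of_gt {i : ℕ} (h : i₀ < i) :
    toggle t i₀ c g (t + 1) i = lowerBound g t i + upperBound g t i - g (t + 1) i := by
  simp only [toggle, h.le, h.ne', and_self, if_true, if_false]

theorem lowerBound_toggle (i : ℕ) : lowerBound (toggle t i₀ c g) t i = lowerBound g t i := by
  rw [lowerBound, toggle_of_ne (by omega), toggle_of_ne (by omega), lowerBound]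

theorem upperBound_toggle (i : ℕ) : upperBound (toggle t i₀ c g) t i = upperBound g t i := by
  cases i <;> simp only [upperBound, toggle_of_ne (show t + 2 ≠ t + 1 by omega),
    toggle_of_ne t.succ_ne_self.symm]

theorem toggle_toggle (h : IsGTPattern n nu g) (hc : g (t + 1) i₀ ≤ c) :
    toggle t i₀ c (toggle t i₀ c g) = g := by
  funext s i
  by_cases hs : s = t + 1
  · subst hs
    have := h.lowerBound_le t i
    have := h.le_upperBound t i
    obtain hi | rfl | hi := lt_trichotomy i i₀
    · rw [toggle_of_lt _ hi, toggle_of_lt _ hi]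
    · rw [toggle_self, toggle_self, lowerBound_toggle]
      omega
    · rw [toggle_of_gt hi, toggle_of_gt hi, lowerBound_toggle, upperBound_toggle]
      omega
  · rw [toggle_of_ne hs, toggle_of_ne hs]

theorem lowerBound_le_toggle (h : IsGTPattern n nu g) (hc : g (t + 1) i₀ ≤ c) (i : ℕ) :
    lowerBound g t i ≤ toggle t i₀ c g (t + 1) i := by
  obtain hi | rfl | hi := lt_trichotomy i i₀
  · rw [toggle_of_lt _ hi]
    exact h.lowerBound_le t i
  · rw [toggle_self]
    omega
  · have := h.le_upperBound t i
    rw [toggle_of_gt hi]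
    omega

theorem toggle_le_upperBound (h : IsGTPattern n nu g) (hc : c ≤ upperBound g t i₀) (i : ℕ) :
    toggle t i₀ c g (t + 1) i ≤ upperBound g t i := by
  have := h.lowerBound_le t i
  obtain hi | rfl | hi := lt_trichotomy i i₀
  · rw [toggle_of_lt _ hi]
    exact h.le_upperBound t i
  · rw [toggle_self]
    omega
  · rw [toggle_of_gt hi]
    omega

theorem isGTPattern_toggle (h : IsGTPattern n nu g) (ht : t + 1 < n) (hgc : g (t + 1) i₀ ≤ c)
    (hc : c ≤ upperBound g t i₀) : IsGTPattern n nu (toggle t i₀ c g) where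
  zero i := by rw [toggle_of_ne (by omega), h.zero]
  le_succ s i := by
    obtain rfl | hs := eq_or_ne s t
    · rw [toggle_of_ne (by omega)]
      exact (le_max_left _ _).trans (lowerBound_le_toggle h hgc i)
    obtain rfl | hs' := eq_or_ne s (t + 1)
    · rw [toggle_of_ne (s := t + 2) (by omega)]
      exact (toggle_le_upperBound h hc i).trans (upperBound_le g t i)
    rw [toggle_of_ne hs', toggle_of_ne (by omega)]
    exact h.le_succ s i
  succ_succ_le s i := by
    obtain rfl | hs := eq_or_ne s t
    · rw [toggle_of_ne (s := s) (by omega)]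
      exact (toggle_le_upperBound h hc (i + 1)).trans (min_le_right _ _)
    obtain rfl | hs' := eq_or_ne s (t + 1)
    · rw [toggle_of_ne (s := t + 2) (by omega)]
      exact (le_max_right _ _).trans (lowerBound_le_toggle h hgc i)
    rw [toggle_of_ne hs', toggle_of_ne (by omega)]
    exact h.succ_succ_le s i
  eq_top s hs i := by rw [toggle_of_ne (by omega), h.eq_top s hs]

theorem weight_toggle_of_le {i : ℕ} (hi : i ≤ i₀) (s : ℕ) :
    weight (toggle t i₀ c g) i s = weight g i s :=
  weight_congr fun _ hj => ⟨toggle_of_lt _ (hj.trans_le hi), toggle_of_lt _ (hj.trans_le hi)⟩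

theorem weight_toggle_of_ne {s : ℕ} (hs : s ≠ t) (hs' : s ≠ t + 1) (i : ℕ) :
    weight (toggle t i₀ c g) i s = weight g i s :=
  weight_congr fun j _ => ⟨toggle_of_ne (by omega) j, toggle_of_ne hs' j⟩

-- The term in `lowerBound` telescopes, by `upperBound_succ_add_lowerBound`.
theorem weight_succ_toggle (h : IsGTPattern n nu g) (hgc : g (t + 1) i₀ ≤ c) {N : ℕ}
    (hN : i₀ ≤ N) :
    weight (toggle t i₀ c g) (N + 1) t + weight g i₀ (t + 1) + g (t + 2) i₀ + g t N =
      weight g (N + 1) (t + 1) + weight g i₀ t + c + lowerBound g t N := by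
  induction N, hN using Nat.le_induction with
  | base =>
    rw [weight_succ, weight_succ, weight_toggle_of_le le_rfl, toggle_self,
      toggle_of_ne t.succ_ne_self.symm]
    have := h.lowerBound_le t i₀
    have := h.le_succ (t + 1) i₀
    have : g t i₀ ≤ lowerBound g t i₀ := le_max_left _ _
    lia
  | succ N hN ih =>
    rw [weight_succ, weight_succ g, toggle_of_gt (Nat.lt_succ_of_le hN),
      toggle_of_ne t.succ_ne_self.symm]
    have := h.lowerBound_le t (N + 1)
    have := h.le_upperBound t (N + 1)
    have := h.le_succ (t + 1) (N + 1)
    have := upperBound_succ_add_lowerBound g t N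
    have : g t (N + 1) ≤ lowerBound g t (N + 1) := le_max_left _ _
    lia

theorem weight_toggle (h : IsGTPattern n nu g) (hi₀ : i₀ < n) (hgc : g (t + 1) i₀ ≤ c) :
    weight (toggle t i₀ c g) n t + weight g i₀ (t + 1) + g (t + 2) i₀ =
      weight g n (t + 1) + weight g i₀ t + c := by
  obtain ⟨N, rfl⟩ := Nat.exists_eq_add_one_of_ne_zero (Nat.ne_zero_of_lt hi₀)
  have hlast : lowerBound g t N = g t N := by
    rw [lowerBound, h.eq_zero_of_le (t + 2) le_rfl, Nat.max_zero]
  have := weight_succ_toggle h hgc (Nat.le_of_lt_succ hi₀)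
  lia

theorem weight_toggle_add_weight_toggle_succ (h : IsGTPattern n nu g)
    (h' : IsGTPattern n nu (toggle t i₀ c g)) (i : ℕ) :
    weight (toggle t i₀ c g) i t + weight (toggle t i₀ c g) i (t + 1) =
      weight g i t + weight g i (t + 1) := by
  rw [h.weight_add_weight_succ, h'.weight_add_weight_succ]
  exact sum_congr rfl fun j _ => by
    rw [toggle_of_ne (by omega), toggle_of_ne t.succ_ne_self.symm]

end Toggle

/-- Row `i` breaks dominance at the letter `t`: reading the rows from the top down and each row
from right to left, some letter `t + 1` of row `i` makes part `t + 1` of `mu` plus the content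
read so far larger than part `t`. -/
def FailsAt (mu : ℕ → ℕ) (g : ℕ → ℕ → ℕ) (i t : ℕ) : Prop :=
  mu t + weight g i t < mu (t + 1) + weight g (i + 1) (t + 1)

/-- A pattern is dominant for `mu` if `mu` plus the content of its reading word stays weakly
decreasing all along the word. -/
def IsDominant (mu : ℕ → ℕ) (g : ℕ → ℕ → ℕ) : Prop := ∀ i t, ¬ FailsAt mu g i t

/-- The first failure of dominance in the reading order: the topmost row and, in that row, the
largest letter. -/
structure IsFirstFailure (mu : ℕ → ℕ) (g : ℕ → ℕ → ℕ) (i t : ℕ) : Prop where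
  failsAt : FailsAt mu g i t
  not_failsAt_above : ∀ i' < i, ∀ t', ¬ FailsAt mu g i' t'
  not_failsAt_of_lt : ∀ t', t < t' → ¬ FailsAt mu g i t'

/-- The number of columns of row `i` that are not yet read when the failure at the letter `t`
occurs. -/
def failureColumn (mu : ℕ → ℕ) (g : ℕ → ℕ → ℕ) (i t : ℕ) : ℕ :=
  g (t + 2) i + mu (t + 1) + weight g i (t + 1) - (mu t + weight g i t + 1)

/-- The reflection of a pattern at a failure of dominance: the letters `t` and `t + 1` are
exchanged in the part of the tableau that is read after the failure. -/
def reflectAt (mu : ℕ → ℕ) (i t : ℕ) (g : ℕ → ℕ → ℕ) : ℕ → ℕ → ℕ :=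
  toggle t i (failureColumn mu g i t) g

section Failure

variable {n : ℕ} {mu nu : ℕ → ℕ} {g : ℕ → ℕ → ℕ} {i t : ℕ}

theorem failsAt_iff (h : IsGTPattern n nu g) : FailsAt mu g i t ↔
    g (t + 1) i + mu t + weight g i t < g (t + 2) i + mu (t + 1) + weight g i (t + 1) := by
  have := h.le_succ (t + 1) i
  rw [FailsAt, weight_succ]
  lia

theorem FailsAt.succ_lt (hf : FailsAt mu g i t) (h : IsGTPattern n nu g) (hmu : Antitone mu) :
    t + 1 < n := by
  by_contra! ht
  have := hmu t.le_succ
  rw [FailsAt, h.weight_eq_zero _ ht] at hf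
  lia

theorem exists_isFirstFailure (hd : ¬ IsDominant mu g) (h : IsGTPattern n nu g)
    (hmu : Antitone mu) : ∃ p : ℕ × ℕ, IsFirstFailure mu g p.1 p.2 := by
  classical
  have hex : ∃ i t, FailsAt mu g i t := by
    simpa only [IsDominant, not_forall, not_not] using hd
  let i := Nat.find hex
  have hbound : ∀ t, FailsAt mu g i t → t ≤ n := fun t ht => by
    have := ht.succ_lt h hmu
    omega
  obtain ⟨t, ht⟩ : ∃ t, FailsAt mu g i t := Nat.find_spec hex
  exact ⟨(i, Nat.findGreatest (FailsAt mu g i) n), Nat.findGreatest_spec (hbound t ht) ht,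
    fun i' hi' t' ht' => Nat.find_min hex hi' ⟨t', ht'⟩,
    fun t' ht' hf => Nat.findGreatest_is_greatest ht' (hbound t' hf) hf⟩

theorem failureColumn_reflectAt :
    failureColumn mu (reflectAt mu i t g) i t = failureColumn mu g i t := by
  rw [failureColumn, reflectAt, weight_toggle_of_le le_rfl, weight_toggle_of_le le_rfl,
    toggle_of_ne (by omega), failureColumn]

namespace IsFirstFailure

theorem unique {i' t' : ℕ} (hf : IsFirstFailure mu g i t) (hf' : IsFirstFailure mu g i' t') :
    i = i' ∧ t = t' := by
  obtain rfl : i = i' := le_antisymm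
    (not_lt.mp fun hi => hf.not_failsAt_above i' hi t' hf'.failsAt)
    (not_lt.mp fun hi => hf'.not_failsAt_above i hi t hf.failsAt)
  exact ⟨rfl, le_antisymm
    (not_lt.mp fun ht => hf'.not_failsAt_of_lt t ht hf.failsAt)
    (not_lt.mp fun ht => hf.not_failsAt_of_lt t' ht hf'.failsAt)⟩

theorem succ_le_of_not_failsAt (hf : IsFirstFailure mu g i t) (hmu : Antitone mu) :
    mu (t + 1) + weight g i (t + 1) ≤ mu t + weight g i t := by
  cases i with
  | zero => exact Nat.add_le_add_right (hmu t.le_succ) _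
  | succ i =>
    refine (not_lt.mp (hf.not_failsAt_above i i.lt_succ_self t)).trans ?_
    rw [weight_succ]
    omega

theorem failureColumn_add (hf : IsFirstFailure mu g i t) (h : IsGTPattern n nu g) :
    failureColumn mu g i t + mu t + weight g i t + 1 =
      g (t + 2) i + mu (t + 1) + weight g i (t + 1) := by
  have := (failsAt_iff h).mp hf.failsAt
  rw [failureColumn]
  lia

theorem le_failureColumn (hf : IsFirstFailure mu g i t) (h : IsGTPattern n nu g) :
    g (t + 1) i ≤ failureColumn mu g i t := by
  have := (failsAt_iff h).mp hf.failsAt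
  have := hf.failureColumn_add h
  lia

theorem failureColumn_lt (hf : IsFirstFailure mu g i t) (h : IsGTPattern n nu g)
    (hmu : Antitone mu) : failureColumn mu g i t < g (t + 2) i := by
  have := hf.failureColumn_add h
  have := hf.succ_le_of_not_failsAt hmu
  lia

theorem failureColumn_le_upperBound (hf : IsFirstFailure mu g i t) (h : IsGTPattern n nu g)
    (hmu : Antitone mu) : failureColumn mu g i t ≤ upperBound g t i := by
  have hlt := hf.failureColumn_lt h hmu
  cases i with
  | zero => exact hlt.le
  | succ i =>
    refine le_min hlt.le ?_
    have hadd := hf.failureColumn_add h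
    have habove := (failsAt_iff h).not.mp (hf.not_failsAt_above i i.lt_succ_self t)
    have := h.succ_succ_le (t + 1) i
    have := h.le_succ t i
    have := h.le_succ (t + 1) i
    rw [weight_succ, weight_succ] at hadd
    lia

theorem row_lt (hf : IsFirstFailure mu g i t) (h : IsGTPattern n nu g) (hmu : Antitone mu) :
    i < n := by
  by_contra! hi
  exact Nat.not_lt_zero _ (h.eq_zero_of_le (t + 2) hi ▸ hf.failureColumn_lt h hmu)

theorem isGTPattern_reflectAt (hf : IsFirstFailure mu g i t) (h : IsGTPattern n nu g)
    (hmu : Antitone mu) : IsGTPattern n nu (reflectAt mu i t g) :=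
  isGTPattern_toggle h (hf.failsAt.succ_lt h hmu) (hf.le_failureColumn h)
    (hf.failureColumn_le_upperBound h hmu)

theorem reflectAt_reflectAt (hf : IsFirstFailure mu g i t) (h : IsGTPattern n nu g) :
    reflectAt mu i t (reflectAt mu i t g) = g := by
  rw [reflectAt, failureColumn_reflectAt]
  exact toggle_toggle h (hf.le_failureColumn h)

theorem isFirstFailure_reflectAt (hf : IsFirstFailure mu g i t) (h : IsGTPattern n nu g)
    (hmu : Antitone mu) :
    IsFirstFailure mu (reflectAt mu i t g) i t := by
  have h' := hf.isGTPattern_reflectAt h hmu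
  have hweight : ∀ i' ≤ i, ∀ s, weight (reflectAt mu i t g) i' s = weight g i' s :=
    fun i' hi' s => weight_toggle_of_le hi' s
  refine ⟨?_, fun i' hi' t' hf' => ?_, fun t' ht' hf' => ?_⟩
  · have := hf.failureColumn_add h
    have := h.lowerBound_le t i
    rw [failsAt_iff h', hweight i le_rfl, hweight i le_rfl, reflectAt, toggle_self,
      toggle_of_ne (by omega)]
    lia
  · refine hf.not_failsAt_above i' hi' t' ?_
    rwa [FailsAt, hweight _ hi'.le, hweight _ (Nat.succ_le_of_lt hi')] at hf'
  · refine hf.not_failsAt_of_lt t' ht' ?_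
    rwa [failsAt_iff h', hweight i le_rfl, hweight i le_rfl, reflectAt,
      toggle_of_ne (by omega), toggle_of_ne (by omega), ← failsAt_iff h] at hf'

theorem weight_reflectAt (hf : IsFirstFailure mu g i t) (h : IsGTPattern n nu g)
    (hmu : Antitone mu) :
    mu t + weight (reflectAt mu i t g) n t + 1 = mu (t + 1) + weight g n (t + 1) ∧
      mu (t + 1) + weight (reflectAt mu i t g) n (t + 1) = mu t + weight g n t + 1 := by
  have := hf.failureColumn_add h
  have := weight_toggle h (hf.row_lt h hmu) (hf.le_failureColumn h)
  have := weight_toggle_add_weight_toggle_succ h (hf.isGTPattern_reflectAt h hmu) n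
  simp only [reflectAt]
  lia

end IsFirstFailure

theorem weight_reflectAt_of_ne {s : ℕ} (hs : s ≠ t) (hs' : s ≠ t + 1) (j : ℕ) :
    weight (reflectAt mu i t g) j s = weight g j s :=
  weight_toggle_of_ne hs hs' j

end Failure

open MvPolynomial

section Alternant

variable (R : Type*) [CommRing R] {σ : Type*} [Fintype σ]

/-- The monomial `x^a` with an exponent for each of finitely many variables. -/
noncomputable def xPow (a : σ → ℕ) : MvPolynomial σ R :=
  monomial (Finsupp.equivFunOnFinite.symm a) 1

variable {R}

theorem xPow_add (a b : σ → ℕ) : xPow R (a + b) = xPow R a * xPow R b := by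
  have hsymm : Finsupp.equivFunOnFinite.symm (a + b) =
      Finsupp.equivFunOnFinite.symm a + Finsupp.equivFunOnFinite.symm b :=
    Finsupp.ext fun _ => rfl
  rw [xPow, xPow, xPow, monomial_mul, mul_one, hsymm]

theorem rename_xPow (w : Equiv.Perm σ) (a : σ → ℕ) :
    rename w (xPow R a) = xPow R (a ∘ w.symm) := by
  have hmap : Finsupp.mapDomain w (Finsupp.equivFunOnFinite.symm a) =
      Finsupp.equivFunOnFinite.symm (a ∘ w.symm) :=
    Finsupp.ext fun _ => Finsupp.mapDomain_equiv_apply _ _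
  rw [xPow, rename_monomial, xPow, hmap]

theorem coeff_xPow (a b : σ → ℕ) [Decidable (a = b)] :
    coeff (Finsupp.equivFunOnFinite.symm b) (xPow R a) = if a = b then 1 else 0 := by
  classical
  simp only [xPow, coeff_monomial, EmbeddingLike.apply_eq_iff_eq]

theorem xPow_eq_prod (a : σ → ℕ) : xPow R a = ∏ i, X i ^ a i := by
  rw [xPow, monomial_eq, C_1, one_mul, Finsupp.prod_fintype _ _ fun _ => pow_zero _]
  simp only [Finsupp.equivFunOnFinite_symm_apply_apply]

variable (R) in
/-- The alternant `det (x_i ^ a_j)`. -/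
noncomputable def alternant [DecidableEq σ] (a : σ → ℕ) : MvPolynomial σ R :=
  (Matrix.of fun i j => X i ^ a j).det

theorem alternant_eq_sum [DecidableEq σ] (a : σ → ℕ) :
    alternant R a = ∑ w : Equiv.Perm σ, Equiv.Perm.sign w • rename w (xPow R a) := by
  simp only [alternant, Matrix.det_apply, Matrix.of_apply, xPow_eq_prod, map_prod, map_pow,
    rename_X]

theorem alternant_comp_swap [DecidableEq σ] (a : σ → ℕ) {i j : σ} (h : i ≠ j) :
    alternant R (a ∘ Equiv.swap i j) = -alternant R a := by
  have hdet := Matrix.det_permute' (Equiv.swap i j)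
    (Matrix.of fun i j => (X i : MvPolynomial σ R) ^ a j)
  rw [Equiv.Perm.sign_swap h, Units.val_neg, Units.val_one, Int.cast_neg, Int.cast_one,
    neg_one_mul] at hdet
  exact hdet

theorem alternant_eq_zero [DecidableEq σ] {a : σ → ℕ} {i j : σ} (h : i ≠ j) (ha : a i = a j) :
    alternant R a = 0 :=
  Matrix.det_zero_of_column_eq h fun k => by rw [Matrix.of_apply, Matrix.of_apply, ha]

theorem mul_alternant [DecidableEq σ] {f : MvPolynomial σ R} (hf : f.IsSymmetric) (a : σ → ℕ) :
    f * alternant R a =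
      ∑ w : Equiv.Perm σ, Equiv.Perm.sign w • rename w (f * xPow R a) := by
  rw [alternant_eq_sum, mul_sum]
  exact sum_congr rfl fun w _ => by rw [map_mul, hf w, mul_smul_comm]

theorem coeff_alternant [LinearOrder σ] {a b : σ → ℕ} (ha : StrictAnti a) (hb : StrictAnti b) :
    coeff (Finsupp.equivFunOnFinite.symm b) (alternant R a) = if a = b then 1 else 0 := by
  have hterm : ∀ w : Equiv.Perm σ, w ≠ 1 → a ∘ w.symm ≠ b := fun w hw h => by
    have hab : a = b := (ha.range_inj hb).mp (by rw [← h, w.symm.surjective.range_comp])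
    refine hw (Equiv.ext fun i => ha.injective ?_)
    have hi := congrFun h (w i)
    rwa [Function.comp_apply, Equiv.symm_apply_apply, ← hab, eq_comm] at hi
  rw [alternant_eq_sum, coeff_sum, sum_eq_single 1]
  · rw [Equiv.Perm.sign_one, one_smul, rename_xPow, coeff_xPow]
    rfl
  · intro w _ hw
    rw [coeff_smul, rename_xPow, coeff_xPow, if_neg (hterm w hw), smul_zero]
  · exact fun h => (h (mem_univ _)).elim

theorem alternant_ne_zero [Nontrivial R] [LinearOrder σ] {a : σ → ℕ} (ha : StrictAnti a) :
    alternant R a ≠ 0 := fun h => by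
  have hcoeff := coeff_alternant (R := R) ha ha
  rw [h, coeff_zero, if_pos rfl] at hcoeff
  exact zero_ne_one hcoeff

theorem linearIndependent_alternant [LinearOrder σ] {ι : Type*} {a : ι → σ → ℕ}
    (ha : ∀ i, StrictAnti (a i)) (hinj : a.Injective) :
    LinearIndependent R fun i => alternant R (a i) := by
  classical
  rw [linearIndependent_iff']
  intro s c hc i hi
  have hcoeff := congrArg (coeff (Finsupp.equivFunOnFinite.symm (a i))) hc
  simpa only [coeff_sum, coeff_smul, coeff_alternant (ha _) (ha i), hinj.eq_iff, smul_eq_mul,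
    mul_ite, mul_one, mul_zero, sum_ite_eq', if_pos hi, coeff_zero] using hcoeff

theorem isSymmetric_of_rename_swap {n : ℕ} {f : MvPolynomial (Fin n) R}
    (hf : ∀ t (ht : t + 1 < n), rename (Equiv.swap (⟨t, t.lt_succ_self.trans ht⟩ : Fin n)
      ⟨t + 1, ht⟩) f = f) : f.IsSymmetric := by
  intro w
  cases n with
  | zero => rw [Subsingleton.elim w 1, Equiv.Perm.coe_one, rename_id_apply]
  | succ n =>
    have hw : w ∈ Submonoid.closure
        (Set.range fun i : Fin n => Equiv.swap i.castSucc i.succ) := by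
      rw [Equiv.Perm.mclosure_swap_castSucc_succ]
      trivial
    induction hw using Submonoid.closure_induction with
    | mem x hx =>
      obtain ⟨i, rfl⟩ := hx
      exact hf i (Nat.succ_lt_succ i.2)
    | one => rw [Equiv.Perm.coe_one, rename_id_apply]
    | mul x y _ _ hx hy => rw [Equiv.Perm.coe_mul, ← rename_rename, hy, hx]

variable (R) in
/-- The alternant `a_{lam + rho}` in `n` variables, where `rho = (n - 1, …, 1, 0)`; only the first
`n` entries of `lam` matter. -/
noncomputable def shiftedAlternant (n : ℕ) (lam : ℕ → ℕ) : MvPolynomial (Fin n) R :=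
  alternant R fun t : Fin n => lam t + (n - 1 - t)

section Shifted

variable {n : ℕ} {lam lam' : ℕ → ℕ} {t : ℕ}

theorem strictAnti_add_rho (hlam : Antitone lam) :
    StrictAnti fun t : Fin n => lam t + (n - 1 - t) := by
  intro s t hst
  have := hlam (Fin.val_fin_le.mpr hst.le)
  have := t.2
  have : (s : ℕ) < t := hst
  dsimp only
  omega

theorem comp_swap_eq {a b : ℕ → ℕ} (ht : t + 1 < n) (hb : b t = a (t + 1))
    (hb' : b (t + 1) = a t) (hne : ∀ s, s ≠ t → s ≠ t + 1 → b s = a s) :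
    (fun s : Fin n => a s) ∘ Equiv.swap (⟨t, t.lt_succ_self.trans ht⟩ : Fin n) ⟨t + 1, ht⟩ =
      fun s : Fin n => b s := by
  funext s
  rw [Function.comp_apply, Equiv.swap_apply_def]
  split_ifs with h h'
  · rw [h, hb]
  · rw [h', hb']
  · exact (hne s (fun e => h (Fin.ext e)) fun e => h' (Fin.ext e)).symm

theorem shiftedAlternant_eq_neg (ht : t + 1 < n) (h : lam' t + 1 = lam (t + 1))
    (h' : lam' (t + 1) = lam t + 1) (hne : ∀ s, s ≠ t → s ≠ t + 1 → lam' s = lam s) :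
    shiftedAlternant R n lam' = -shiftedAlternant R n lam := by
  have hswap := comp_swap_eq (a := fun t => lam t + (n - 1 - t))
    (b := fun t => lam' t + (n - 1 - t)) ht (by omega) (by omega)
    fun s hs hs' => by rw [hne s hs hs']
  rw [shiftedAlternant, ← hswap, alternant_comp_swap _ (by simp [Fin.ext_iff]), shiftedAlternant]

theorem shiftedAlternant_eq_zero (ht : t + 1 < n) (h : lam (t + 1) = lam t + 1) :
    shiftedAlternant R n lam = 0 :=
  alternant_eq_zero (i := ⟨t, t.lt_succ_self.trans ht⟩) (j := ⟨t + 1, ht⟩)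
    (by simp [Fin.ext_iff]) (by simp only [h]; omega)

theorem linearIndependent_shiftedAlternant {ι : Type*} {f : ι → ℕ → ℕ}
    (hf : ∀ i, Antitone (f i)) (hinj : Function.Injective fun i (t : Fin n) => f i t) :
    LinearIndependent R fun i => shiftedAlternant R n (f i) :=
  linearIndependent_alternant (fun i => strictAnti_add_rho (hf i)) fun _ _ h =>
    hinj (funext fun t => Nat.add_right_cancel (congrFun h t))

end Shifted

end Alternant

section SchurPoly

variable (R : Type*) [CommRing R]

/-- The Schur polynomial in `n` variables, as a sum over Gelfand–Tsetlin patterns. -/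
noncomputable def schurPoly (n : ℕ) (nu : ℕ → ℕ) : MvPolynomial (Fin n) R :=
  ∑ g ∈ gtPatterns n nu, xPow R fun t : Fin n => weight g n t

/-- The reflection of a pattern at its first failure of dominance, if there is one. -/
noncomputable def reflect (mu : ℕ → ℕ) (g : ℕ → ℕ → ℕ) : ℕ → ℕ → ℕ :=
  open Classical in
  if h : ∃ p : ℕ × ℕ, IsFirstFailure mu g p.1 p.2 then reflectAt mu h.choose.1 h.choose.2 g else g

variable {R} {n : ℕ} {mu nu : ℕ → ℕ} {g : ℕ → ℕ → ℕ}

theorem IsFirstFailure.reflect_eq {i t : ℕ} (hf : IsFirstFailure mu g i t) :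
    reflect mu g = reflectAt mu i t g := by
  have hex : ∃ p : ℕ × ℕ, IsFirstFailure mu g p.1 p.2 := ⟨(i, t), hf⟩
  obtain ⟨hi, ht⟩ := hex.choose_spec.unique hf
  rw [reflect, dif_pos hex, hi, ht]

theorem isSymmetric_schurPoly : (schurPoly R n nu).IsSymmetric := by
  refine isSymmetric_of_rename_swap fun t ht => ?_
  let bk : (ℕ → ℕ → ℕ) → ℕ → ℕ → ℕ := fun g => toggle t 0 (g (t + 2) 0) g
  have hbk : ∀ g, IsGTPattern n nu g → IsGTPattern n nu (bk g) := fun g h =>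
    isGTPattern_toggle h ht (h.le_succ (t + 1) 0) le_rfl
  have hbk_bk : ∀ g, IsGTPattern n nu g → bk (bk g) = g := fun g h => by
    simp only [bk, toggle_of_ne (show t + 2 ≠ t + 1 by omega)]
    exact toggle_toggle h (h.le_succ (t + 1) 0)
  rw [schurPoly, map_sum]
  simp only [rename_xPow, Equiv.symm_swap]
  refine sum_nbij' bk bk (fun g hg => mem_gtPatterns.mpr (hbk g (mem_gtPatterns.mp hg)))
    (fun g hg => mem_gtPatterns.mpr (hbk g (mem_gtPatterns.mp hg)))
    (fun g hg => hbk_bk g (mem_gtPatterns.mp hg)) (fun g hg => hbk_bk g (mem_gtPatterns.mp hg))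
    fun g hg => congrArg (xPow R) ?_
  have h := mem_gtPatterns.mp hg
  have hsum := weight_toggle_add_weight_toggle_succ h (hbk g h) n
  have ht' := weight_toggle h (Nat.zero_lt_of_lt ht) (h.le_succ (t + 1) 0)
  simp only [weight_zero] at ht'
  exact comp_swap_eq ht (by dsimp only [bk]; lia) (by dsimp only [bk]; lia)
    fun s hs hs' => weight_toggle_of_ne hs hs' n

theorem schurPoly_mul_shiftedAlternant_eq_sum (mu : ℕ → ℕ) :
    schurPoly R n nu * shiftedAlternant R n mu =
      ∑ g ∈ gtPatterns n nu, shiftedAlternant R n (mu + weight g n) := by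
  rw [shiftedAlternant, mul_alternant isSymmetric_schurPoly]
  simp only [schurPoly, sum_mul, map_sum, smul_sum, ← xPow_add]
  rw [sum_comm]
  refine sum_congr rfl fun g _ => ?_
  rw [← alternant_eq_sum, shiftedAlternant]
  congr 1
  funext t
  simp only [Pi.add_apply]
  ring

theorem shiftedAlternant_weight_add_reflect {g : ℕ → ℕ → ℕ} (h : IsGTPattern n nu g)
    (hmu : Antitone mu) (hd : ¬ IsDominant mu g) :
    shiftedAlternant R n (mu + weight g n) +
      shiftedAlternant R n (mu + weight (reflect mu g) n) = 0 := by
  obtain ⟨⟨i, t⟩, hf⟩ := exists_isFirstFailure hd h hmu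
  obtain ⟨hw, hw'⟩ := hf.weight_reflectAt h hmu
  have hne : ∀ s, s ≠ t → s ≠ t + 1 →
      (mu + weight (reflectAt mu i t g) n) s = (mu + weight g n) s := fun s hs hs' => by
    rw [Pi.add_apply, Pi.add_apply, weight_reflectAt_of_ne hs hs']
  rw [hf.reflect_eq, shiftedAlternant_eq_neg (hf.failsAt.succ_lt h hmu) hw hw' hne,
    add_neg_cancel]

theorem shiftedAlternant_eq_zero_of_reflect_eq (h : IsGTPattern n nu g) (hmu : Antitone mu)
    (hd : ¬ IsDominant mu g) (heq : reflect mu g = g) :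
    shiftedAlternant R n (mu + weight g n) = 0 := by
  obtain ⟨⟨i, t⟩, hf⟩ := exists_isFirstFailure hd h hmu
  obtain ⟨-, hw'⟩ := hf.weight_reflectAt h hmu
  rw [← hf.reflect_eq, heq] at hw'
  exact shiftedAlternant_eq_zero (hf.failsAt.succ_lt h hmu) hw'

open Classical in
theorem sum_shiftedAlternant_not_isDominant (hmu : Antitone mu) :
    ∑ g ∈ gtPatterns n nu with ¬ IsDominant mu g, shiftedAlternant R n (mu + weight g n) = 0 := by
  have hmem : ∀ {g}, g ∈ ({g ∈ gtPatterns n nu | ¬ IsDominant mu g} : Finset _) ↔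
      IsGTPattern n nu g ∧ ¬ IsDominant mu g := by
    simp only [mem_filter, mem_gtPatterns, implies_true]
  refine sum_involution (fun g _ => reflect mu g) (fun g hg => ?_) (fun g hg hne heq => ?_)
    (fun g hg => ?_) fun g hg => ?_
  all_goals obtain ⟨h, hd⟩ := hmem.mp hg
  · exact shiftedAlternant_weight_add_reflect h hmu hd
  · exact hne (shiftedAlternant_eq_zero_of_reflect_eq h hmu hd heq)
  all_goals
    obtain ⟨⟨i, t⟩, hf⟩ := exists_isFirstFailure hd h hmu
    have hf' := hf.isFirstFailure_reflectAt h hmu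
  · rw [hf.reflect_eq, hmem]
    exact ⟨hf.isGTPattern_reflectAt h hmu, fun hd' => hd' _ _ hf'.failsAt⟩
  · rw [hf.reflect_eq, hf'.reflect_eq, hf.reflectAt_reflectAt h]

open Classical in
theorem schurPoly_mul_shiftedAlternant (hmu : Antitone mu) :
    schurPoly R n nu * shiftedAlternant R n mu =
      ∑ g ∈ gtPatterns n nu with IsDominant mu g, shiftedAlternant R n (mu + weight g n) := by
  rw [schurPoly_mul_shiftedAlternant_eq_sum, ← sum_filter_add_sum_filter_not _ (IsDominant mu),
    sum_shiftedAlternant_not_isDominant hmu, add_zero]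

/-- The pattern of the tableau with all entries in row `i` equal to `i`. -/
def highestPattern (nu : ℕ → ℕ) (s i : ℕ) : ℕ := if i < s then nu i else 0

theorem isGTPattern_highestPattern (hnu : Antitone nu) (h0 : nu n = 0) :
    IsGTPattern n nu (highestPattern nu) where
  zero i := if_neg i.not_lt_zero
  le_succ s i := by
    simp only [highestPattern]
    split_ifs <;> omega
  succ_succ_le s i := by
    have := hnu i.le_succ
    simp only [highestPattern]
    split_ifs <;> omega
  eq_top s hs i := by
    simp only [highestPattern, ite_eq_left_iff, not_lt]
    exact fun hi => (Nat.le_zero.mp (h0 ▸ hnu (hs.trans hi))).symm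

theorem weight_highestPattern (nu : ℕ → ℕ) (i t : ℕ) :
    weight (highestPattern nu) i t = if t < i then nu t else 0 := by
  have hterm : ∀ j, highestPattern nu (t + 1) j - highestPattern nu t j =
      if t = j then nu j else 0 := fun j => by
    simp only [highestPattern]
    split_ifs <;> omega
  simp only [weight, hterm, sum_ite_eq, mem_range]

theorem isDominant_zero_highestPattern (hnu : Antitone nu) :
    IsDominant 0 (highestPattern nu) := fun i t h => by
  have := hnu (show t ≤ t + 1 from t.le_succ)
  simp only [FailsAt, weight_highestPattern, Pi.zero_apply] at h
  split_ifs at h <;> omega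

theorem IsDominant.weight_eq_zero (hd : IsDominant 0 g) {i t : ℕ} (hit : i ≤ t) :
    weight g i t = 0 := by
  induction i generalizing t with
  | zero => rfl
  | succ i ih =>
    obtain ⟨t, rfl⟩ := Nat.exists_eq_add_one_of_ne_zero (Nat.ne_zero_of_lt hit)
    have := not_lt.mp (hd i t)
    simp only [Pi.zero_apply, ih (Nat.le_of_succ_le_succ hit)] at this
    omega

theorem IsGTPattern.eq_highestPattern (h : IsGTPattern n nu g) (hd : IsDominant 0 g) :
    g = highestPattern nu := by
  funext s i
  rw [highestPattern]
  split_ifs with his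
  · have hconst : ∀ s' ≥ s, g s' i = g s i := fun s' hs' => by
      induction s', hs' using Nat.le_induction with
      | base => rfl
      | succ t hst ih =>
        have := (sum_eq_zero_iff.mp (hd.weight_eq_zero (his.trans_le hst))) i
          (mem_range.mpr i.lt_succ_self)
        have := h.le_succ t i
        omega
    rw [← hconst _ (le_max_left s n), h.eq_top _ (le_max_right s n)]
  · exact h.eq_zero (not_lt.mp his)

theorem schurPoly_mul_shiftedAlternant_zero (hnu : Antitone nu) (h0 : nu n = 0) :
    schurPoly R n nu * shiftedAlternant R n 0 = shiftedAlternant R n nu := by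
  classical
  have hsingle : {g ∈ gtPatterns n nu | IsDominant 0 g} = {highestPattern nu} := by
    ext g
    rw [mem_filter, mem_gtPatterns, mem_singleton]
    refine ⟨fun ⟨h, hd⟩ => h.eq_highestPattern hd, ?_⟩
    rintro rfl
    exact ⟨isGTPattern_highestPattern hnu h0, isDominant_zero_highestPattern hnu⟩
  rw [schurPoly_mul_shiftedAlternant (mu := 0) antitone_const, hsingle, sum_singleton,
    shiftedAlternant,
    shiftedAlternant]
  congr 1
  funext t
  rw [zero_add, weight_highestPattern, if_pos t.2]

theorem linearIndependent_schurPoly {ι : Type*} {f : ι → ℕ → ℕ}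
    (hf : ∀ i, Antitone (f i)) (h0 : ∀ i, f i n = 0) (hinj : f.Injective) :
    LinearIndependent R fun i => schurPoly R n (f i) := by
  have hzero : ∀ i {t}, n ≤ t → f i t = 0 := fun i _ ht =>
    Nat.le_zero.mp ((hf i ht).trans (h0 i).le)
  refine LinearIndependent.of_comp (LinearMap.mulRight R (shiftedAlternant R n 0)) ?_
  simp only [Function.comp_def, LinearMap.mulRight_apply,
    schurPoly_mul_shiftedAlternant_zero (hf _) (h0 _)]
  refine linearIndependent_shiftedAlternant hf fun i j hij => hinj (funext fun t => ?_)
  obtain ht | ht := lt_or_ge t n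
  · exact congrFun hij ⟨t, ht⟩
  · rw [hzero i ht, hzero j ht]

end SchurPoly

theorem lt_card_filter_range_iff {p : ℕ → Prop} [DecidablePred p] {N j : ℕ}
    (hp : ∀ a b, a ≤ b → b < N → p b → p a) : j < #{a ∈ range N | p a} ↔ j < N ∧ p j := by
  have hmem : ∀ {a}, a ∈ ({a ∈ range N | p a} : Finset ℕ) ↔ a < N ∧ p a := by
    simp only [mem_filter, mem_range, implies_true]
  refine ⟨fun h => ?_, fun ⟨hj, hpj⟩ => ?_⟩
  · rw [← card_range j] at h
    obtain ⟨b, hb, hbj⟩ := exists_mem_notMem_of_card_lt_card h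
    have hjb := not_lt.mp (mt mem_range.mpr hbj)
    exact ⟨hjb.trans_lt (hmem.mp hb).1, hp j b hjb (hmem.mp hb).1 (hmem.mp hb).2⟩
  · rw [← Nat.succ_le_iff, ← card_range j.succ]
    refine card_le_card fun a ha => ?_
    have haj := Nat.lt_succ_iff.mp (mem_range.mp ha)
    exact hmem.mpr ⟨haj.trans_lt hj, hp a j haj hj hpj⟩

theorem antitone_rowLen (lam : YoungDiagram) : Antitone lam.rowLen := fun i j h =>
  lam.rowLen_anti i j h

theorem rowLen_injective : Function.Injective YoungDiagram.rowLen := fun al be h =>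
  YoungDiagram.ext (Finset.ext fun p => by
    rw [YoungDiagram.mem_cells, YoungDiagram.mem_cells, YoungDiagram.mem_iff_lt_rowLen,
      YoungDiagram.mem_iff_lt_rowLen, h])

theorem sum_cells {M : Type*} [AddCommMonoid M] {lam : YoungDiagram} {n : ℕ}
    (h : lam.rowLen n = 0) (f : ℕ × ℕ → M) :
    ∑ b ∈ lam.cells, f b = ∑ i ∈ range n, ∑ j ∈ range (lam.rowLen i), f (i, j) := by
  refine sum_finset_product _ _ _ fun p => ?_
  rw [YoungDiagram.mem_cells, mem_range, mem_range, ← YoungDiagram.mem_iff_lt_rowLen]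
  refine ⟨fun hp => ⟨?_, hp⟩, fun hp => hp.2⟩
  by_contra! hn
  exact (YoungDiagram.mem_iff_lt_rowLen.mp hp).not_ge
    ((antitone_rowLen lam hn).trans (h.le.trans (Nat.zero_le _)))

section Tableau

variable {lam : YoungDiagram} {n : ℕ}

/-- The Gelfand–Tsetlin pattern of a semistandard tableau. -/
def levels (T : SemistandardYoungTableau lam) (s i : ℕ) : ℕ :=
  #{j ∈ range (lam.rowLen i) | T i j < s}

theorem lt_levels_iff (T : SemistandardYoungTableau lam) {s i j : ℕ} :
    j < levels T s i ↔ j < lam.rowLen i ∧ T i j < s :=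
  lt_card_filter_range_iff fun _ _ hab hb hT =>
    (T.row_weak_of_le hab (YoungDiagram.mem_iff_lt_rowLen.mpr hb)).trans_lt hT

theorem levels_injective : Function.Injective (levels (lam := lam)) := fun T T' h => by
  ext i j
  by_cases hj : j < lam.rowLen i
  · refine eq_of_forall_gt_iff fun s => ?_
    rw [← and_iff_right (b := T i j < s) hj, ← lt_levels_iff, h, lt_levels_iff, and_iff_right hj]
  · rw [← YoungDiagram.mem_iff_lt_rowLen] at hj
    rw [T.zeros hj, T'.zeros hj]

theorem isGTPattern_levels {T : SemistandardYoungTableau lam}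
    (hT : ∀ i j, j < lam.rowLen i → T i j < n) : IsGTPattern n lam.rowLen (levels T) where
  zero i := by simp only [levels, Nat.not_lt_zero, filter_false, card_empty]
  le_succ s i := le_of_forall_lt fun j hj => by
    rw [lt_levels_iff] at hj ⊢
    exact ⟨hj.1, hj.2.trans s.lt_succ_self⟩
  succ_succ_le s i := le_of_forall_lt fun j hj => by
    rw [lt_levels_iff] at hj ⊢
    have := T.col_strict (Nat.lt_add_one i) (YoungDiagram.mem_iff_lt_rowLen.mpr hj.1)
    exact ⟨hj.1.trans_le (antitone_rowLen lam i.le_succ), by omega⟩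
  eq_top s hs i := eq_of_forall_lt_iff fun j => by
    rw [lt_levels_iff, and_iff_left_iff_imp]
    exact fun hj => (hT i j hj).trans_le hs

theorem levels_succ (T : SemistandardYoungTableau lam) (t i : ℕ) :
    levels T (t + 1) i =
      levels T t i + ∑ j ∈ range (lam.rowLen i), (Finsupp.single (T i j) 1 : ℕ →₀ ℕ) t := by
  simp only [levels, card_filter, ← sum_add_distrib, Finsupp.single_apply]
  refine sum_congr rfl fun j _ => ?_
  split_ifs <;> omega

theorem content_eq_weight (T : SemistandardYoungTableau lam) (h : lam.rowLen n = 0) (t : ℕ) :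
    content T t = weight (levels T) n t := by
  rw [content, sum_apply', sum_cells h, weight]
  exact sum_congr rfl fun i _ => by rw [levels_succ, Nat.add_sub_cancel_left]

theorem apply_lt_of_content_eq_zero {T : SemistandardYoungTableau lam}
    (hT : ∀ t, n ≤ t → content T t = 0) (i j : ℕ) (hj : j < lam.rowLen i) : T i j < n := by
  by_contra! hn
  have hcontent := hT (T i j) hn
  rw [content, sum_apply', sum_eq_zero_iff] at hcontent
  have hcell := hcontent (i, j) (YoungDiagram.mem_iff_lt_rowLen.mpr hj)
  rw [Finsupp.single_eq_same] at hcell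
  exact one_ne_zero hcell

theorem content_eq_embDomain_iff {T : SemistandardYoungTableau lam} {d : Fin n →₀ ℕ} :
    content T = Finsupp.embDomain Fin.valEmbedding d ↔
      IsGTPattern n lam.rowLen (levels T) ∧ ∀ t : Fin n, weight (levels T) n t = d t := by
  have hd : ∀ t, n ≤ t → Finsupp.embDomain Fin.valEmbedding d t = 0 := fun t ht =>
    Finsupp.embDomain_of_notMem_range _ _ _ fun ⟨s, hs⟩ => (hs.symm.trans_lt s.2).not_ge ht
  refine ⟨fun hT => ?_, fun ⟨h, hT⟩ => Finsupp.ext fun t => ?_⟩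
  · have h := isGTPattern_levels (apply_lt_of_content_eq_zero fun t ht => by rw [hT, hd t ht])
    refine ⟨h, fun t => ?_⟩
    rw [← content_eq_weight T (h.top_eq_zero le_rfl), hT]
    exact Finsupp.embDomain_apply_self Fin.valEmbedding d t
  · rw [content_eq_weight T (h.top_eq_zero le_rfl)]
    obtain ht | ht := lt_or_ge t n
    · exact (hT ⟨t, ht⟩).trans (Finsupp.embDomain_apply_self Fin.valEmbedding d ⟨t, ht⟩).symm
    · rw [h.weight_eq_zero n ht, hd t ht]

namespace IsGTPattern

variable {nu : ℕ → ℕ} {g : ℕ → ℕ → ℕ}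

theorem sInf_lt_iff (h : IsGTPattern n nu g) {s i j : ℕ} (hj : j < nu i) :
    sInf {s | j < g (s + 1) i} < s ↔ j < g s i := by
  have hne : {s | j < g (s + 1) i}.Nonempty :=
    ⟨n, show j < g (n + 1) i by rwa [h.eq_top (n + 1) n.le_succ]⟩
  rw [csInf_lt_iff (OrderBot.bddBelow _) hne]
  refine ⟨fun ⟨s', hjs', hs'⟩ => lt_of_lt_of_le hjs' (h.monotone i hs'), fun hjs => ?_⟩
  cases s with
  | zero => exact absurd hjs ((h.zero i).trans_le j.zero_le).not_gt
  | succ s => exact ⟨s, hjs, s.lt_succ_self⟩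

/-- The semistandard tableau of a Gelfand–Tsetlin pattern. Outside the diagram the infimum is over
the empty set, hence `0`. -/
noncomputable def tableau (h : IsGTPattern n lam.rowLen g) : SemistandardYoungTableau lam where
  entry i j := sInf {s | j < g (s + 1) i}
  row_weak' {i j j'} hj hcell := by
    rw [YoungDiagram.mem_iff_lt_rowLen] at hcell
    rw [← Nat.lt_succ_iff, h.sInf_lt_iff (hj.trans hcell)]
    exact hj.trans ((h.sInf_lt_iff hcell).mp (Nat.lt_succ_self _))
  col_strict' {i i' j} hi hcell := by
    rw [YoungDiagram.mem_iff_lt_rowLen] at hcell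
    rw [h.sInf_lt_iff (hcell.trans_le (antitone_rowLen lam hi.le))]
    exact ((h.sInf_lt_iff hcell).mp (Nat.lt_succ_self _)).trans_le
      ((h.antitone _ hi).trans (h.succ_succ_le _ i))
  zeros' {i j} hcell := by
    rw [YoungDiagram.mem_iff_lt_rowLen, not_lt] at hcell
    have hempty : {s | j < g (s + 1) i} = ∅ :=
      Set.eq_empty_of_forall_notMem fun s hs =>
        absurd ((h.le_top (s + 1) i).trans hcell) (not_le.mpr hs)
    rw [hempty, Nat.sInf_empty]

theorem levels_tableau (h : IsGTPattern n lam.rowLen g) : levels h.tableau = g := by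
  funext s i
  refine eq_of_forall_lt_iff fun j => ?_
  rw [lt_levels_iff]
  refine ⟨fun ⟨hj, hs⟩ => (h.sInf_lt_iff hj).mp hs, fun hj => ?_⟩
  have hjtop := hj.trans_le (h.le_top s i)
  exact ⟨hjtop, (h.sInf_lt_iff hjtop).mpr hj⟩

end IsGTPattern

open Classical in
theorem image_levels_eq (lam : YoungDiagram) (d : Fin n →₀ ℕ) :
    levels '' {T : SemistandardYoungTableau lam |
        content T = Finsupp.embDomain Fin.valEmbedding d} =
      ({g ∈ gtPatterns n lam.rowLen | ∀ t : Fin n, weight g n t = d t} : Finset _) := by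
  ext g
  simp only [Set.mem_image, Set.mem_ofPred_eq, content_eq_embDomain_iff, coe_filter, mem_gtPatterns]
  constructor
  · rintro ⟨T, hT, rfl⟩
    exact hT
  · exact fun hg => ⟨hg.1.tableau, by rwa [hg.1.levels_tableau], hg.1.levels_tableau⟩

theorem killCompl_schur (n : ℕ) (lam : YoungDiagram) :
    MvPowerSeries.killCompl (Fin.valEmbedding (n := n)) (schur lam) =
      (schurPoly ℂ n lam.rowLen : MvPowerSeries (Fin n) ℂ) := by
  classical
  ext d
  have hcard : MvPowerSeries.coeff (Finsupp.embDomain Fin.valEmbedding d) (schur lam) =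
      ({T : SemistandardYoungTableau lam |
        content T = Finsupp.embDomain Fin.valEmbedding d}.ncard : ℂ) := rfl
  obtain ⟨d, rfl⟩ := Finsupp.equivFunOnFinite.symm.surjective d
  rw [MvPowerSeries.coeff_killCompl, hcard, ← Set.ncard_image_of_injective _ levels_injective,
    image_levels_eq, Set.ncard_coe_finset, MvPolynomial.coeff_coe, schurPoly, coeff_sum,
    card_filter, Nat.cast_sum]
  refine sum_congr rfl fun g _ => ?_
  rw [coeff_xPow, Nat.cast_ite, Nat.cast_one, Nat.cast_zero]
  exact if_congr funext_iff.symm rfl rfl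

end Tableau

theorem eq_of_killCompl_eq {R : Type*} [CommSemiring R] {f f' : MvPowerSeries ℕ R} (N : ℕ)
    (h : ∀ n ≥ N, MvPowerSeries.killCompl (Fin.valEmbedding (n := n)) f =
      MvPowerSeries.killCompl Fin.valEmbedding f') : f = f' := by
  ext d
  have hd : d ∈ Set.range
      (Finsupp.embDomain (Fin.valEmbedding (n := max N (d.support.sup id + 1)))) := by
    rw [Finsupp.mem_range_embDomain_iff]
    intro t ht
    exact ⟨⟨t, lt_max_of_lt_right (Nat.lt_succ_of_le (le_sup (f := id) ht))⟩, rfl⟩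
  obtain ⟨e, he⟩ := hd
  rw [← he, ← MvPowerSeries.coeff_killCompl, h _ (le_max_left _ _), MvPowerSeries.coeff_killCompl]

theorem linearIndependent_schur : LinearIndependent ℂ schur := by
  rw [linearIndependent_iff_finset_linearIndependent]
  intro s
  let n := s.sup fun lam => lam.colLen 0
  have hn : ∀ lam : s, lam.1.rowLen n = 0 := fun lam =>
    rowLen_eq_zero_iff.mpr (le_sup (f := fun lam : YoungDiagram => lam.colLen 0) lam.2)
  have hpoly : LinearIndependent ℂ fun lam : s => schurPoly ℂ n lam.1.rowLen :=
    linearIndependent_schurPoly (fun lam => antitone_rowLen lam.1) hn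
      (rowLen_injective.comp Subtype.val_injective)
  refine LinearIndependent.of_comp
    (MvPowerSeries.killCompl (Fin.valEmbedding (n := n))).toLinearMap ?_
  simp only [Function.comp_def, AlgHom.toLinearMap_apply, killCompl_schur]
  let toSeries : MvPolynomial (Fin n) ℂ →ₗ[ℂ] MvPowerSeries (Fin n) ℂ :=
    { toFun := (↑), map_add' := coe_add, map_smul' := fun c p => coe_smul p c }
  exact hpoly.map' toSeries (LinearMap.ker_eq_bot.mpr (coe_injective _ _))

section Stage

variable {l : ℕ} {q q' : Fin (l + 1) → YoungDiagram}

/-- The `i`-th term of a sequence of diagrams, continued constantly after the last term. -/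
def stage (q : Fin (l + 1) → YoungDiagram) (i : ℕ) : YoungDiagram := q (Fin.clamp i l)

theorem stage_val (i : Fin (l + 1)) : stage q i = q i :=
  congrArg q (Fin.ext (by rw [Fin.coe_clamp]; omega))

theorem stage_zero : stage q 0 = q 0 := stage_val 0

theorem stage_of_le {i : ℕ} (hi : l ≤ i) : stage q i = q (Fin.last l) :=
  congrArg q (Fin.clamp_eq_last i l hi)

theorem stage_injective : Function.Injective (stage (l := l)) := fun q q' h => by
  funext i
  rw [← stage_val (q := q), h, stage_val]

/-- The companion pattern of a sequence of diagrams: `companion q s i` is the number of cells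
that the step from term `i` to term `i + 1` adds to the first `s` rows. -/
def companion (q : Fin (l + 1) → YoungDiagram) (s i : ℕ) : ℕ :=
  ∑ t ∈ range s, ((stage q (i + 1)).rowLen t - (stage q i).rowLen t)

theorem companion_zero (i : ℕ) : companion q 0 i = 0 := rfl

theorem companion_succ (s i : ℕ) : companion q (s + 1) i =
    companion q s i + ((stage q (i + 1)).rowLen s - (stage q i).rowLen s) :=
  sum_range_succ _ _

theorem companion_eq_zero (s : ℕ) {i : ℕ} (hi : l ≤ i) : companion q s i = 0 :=
  sum_eq_zero fun t _ => by rw [stage_of_le hi, stage_of_le (by omega), Nat.sub_self]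

end Stage

theorem k_eq_sum_range (m : ℕ → ℕ → ℕ) (i j : ℕ) : k m i j = ∑ t ∈ range j, m i (t + 1) := by
  rw [k, ← Ico_add_one_right_eq_Icc, sum_Ico_eq_sum_range]
  simp only [Nat.add_sub_cancel, add_comm 1]

section LRSequence

variable {mu nu : YoungDiagram} {q : Fin (u nu 1 + 1) → YoungDiagram}

theorem rowLen_eq_zero_of_u_le {i : ℕ} (hi : u nu 1 ≤ i) : nu.rowLen i = 0 :=
  rowLen_eq_zero_iff.mpr (u_succ nu 0 ▸ hi)

namespace IsLRSequence

theorem exists_isStep (h : IsLRSequence mu nu q) : ∃ m : ℕ → ℕ → ℕ,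
    (∀ i < u nu 1, IsStep (stage q i) (stage q (i + 1)) (nu.rowLen i) (m (i + 1))) ∧
      (∀ i < u nu 1, ∀ s, companion q s i = k m (i + 1) s) ∧
      ∀ i, i + 1 < u nu 1 → ∀ s, k m (i + 2) (s + 1) ≤ k m (i + 1) s := by
  obtain ⟨-, m, hstep, hk⟩ := h
  have hstep' : ∀ i < u nu 1, IsStep (stage q i) (stage q (i + 1)) (nu.rowLen i) (m (i + 1)) :=
    fun i hi => by
      have := hstep ⟨i, hi⟩
      rwa [r_succ, ← stage_val (q := q), ← stage_val (q := q)] at this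
  refine ⟨m, hstep', fun i hi s => ?_, fun i hi s => hk (i + 2) (s + 1) ?_ ?_ ?_⟩
  · obtain ⟨-, -, hrow, -⟩ := (isStep_iff (Nat.lt_succ_self _)).mp (hstep' i hi)
    rw [k_eq_sum_range, companion]
    exact sum_congr rfl fun t _ => by rw [hrow, Nat.add_sub_cancel_left]
  all_goals omega

theorem isHorizontalStrip (h : IsLRSequence mu nu q) (i : ℕ) :
    IsHorizontalStrip (stage q i) (stage q (i + 1)) := by
  obtain hi | hi := lt_or_ge i (u nu 1)
  · obtain ⟨m, hstep, -⟩ := h.exists_isStep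
    exact ((isStep_iff (Nat.lt_succ_self _)).mp (hstep i hi)).1
  · rw [stage_of_le hi, stage_of_le (by omega)]
    exact fun a => ⟨le_rfl, antitone_rowLen _ a.le_succ⟩

theorem companion_eq (h : IsLRSequence mu nu q) {s i : ℕ} (hs : (stage q i).colLen 0 < s) :
    companion q s i = nu.rowLen i := by
  obtain hi | hi := lt_or_ge i (u nu 1)
  · obtain ⟨m, hstep, hcomp, -⟩ := h.exists_isStep
    rw [hcomp i hi, k_eq_sum_range, ((isStep_iff hs).mp (hstep i hi)).2.2.2]
  · rw [companion_eq_zero s hi, rowLen_eq_zero_of_u_le hi]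

theorem companion_succ_succ_le (h : IsLRSequence mu nu q) (s i : ℕ) :
    companion q (s + 1) (i + 1) ≤ companion q s i := by
  obtain hi | hi := lt_or_ge (i + 1) (u nu 1)
  · obtain ⟨m, -, hcomp, hk⟩ := h.exists_isStep
    rw [hcomp _ hi, hcomp i (by omega)]
    exact hk i hi s
  · rw [companion_eq_zero _ hi]
    exact Nat.zero_le _

theorem colLen_stage_le (h : IsLRSequence mu nu q) (i : ℕ) :
    (stage q i).colLen 0 ≤ mu.colLen 0 + i := by
  induction i with
  | zero => rw [stage_zero, h.1, add_zero]
  | succ i ih =>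
    have := (h.isHorizontalStrip i (mu.colLen 0 + i)).2
    rw [rowLen_eq_zero_iff.mpr ih, Nat.le_zero] at this
    exact rowLen_eq_zero_iff.mp this

theorem isGTPattern_companion (h : IsLRSequence mu nu q) {n : ℕ}
    (hn : mu.colLen 0 + nu.colLen 0 ≤ n) : IsGTPattern n nu.rowLen (companion q) where
  zero := companion_zero
  le_succ s i := companion_succ s i ▸ Nat.le_add_right _ _
  succ_succ_le := h.companion_succ_succ_le
  eq_top s hs i := by
    obtain hi | hi := lt_or_ge i (u nu 1)
    · have := h.colLen_stage_le i
      rw [u_succ] at hi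
      exact h.companion_eq (by omega)
    · rw [companion_eq_zero s hi, rowLen_eq_zero_of_u_le hi]

theorem rowLen_stage (h : IsLRSequence mu nu q) (i : ℕ) :
    (stage q i).rowLen = mu.rowLen + weight (companion q) i := by
  induction i with
  | zero => rw [stage_zero, h.1]; rfl
  | succ i ih =>
    funext t
    have := (h.isHorizontalStrip i t).1
    have := congrFun ih t
    simp only [Pi.add_apply, weight_succ, companion_succ] at *
    omega

theorem isDominant_companion (h : IsLRSequence mu nu q) :
    IsDominant mu.rowLen (companion q) := fun i t hf => by
  have := (h.isHorizontalStrip i t).2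
  rw [h.rowLen_stage, h.rowLen_stage] at this
  exact this.not_gt hf

end IsLRSequence

theorem companion_injOn : Set.InjOn companion {q | IsLRSequence mu nu q} :=
  fun q hq q' hq' h => stage_injective <| funext fun i => rowLen_injective <| by
    rw [IsLRSequence.rowLen_stage hq, IsLRSequence.rowLen_stage hq', h]

theorem finite_setOf_isLRSequence (mu nu : YoungDiagram) :
    {q : Fin (u nu 1 + 1) → YoungDiagram | IsLRSequence mu nu q}.Finite :=
  (finite_setOf_isGTPattern _ _).of_injOn
    (fun _ hq => IsLRSequence.isGTPattern_companion hq le_rfl) companion_injOn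

theorem isLRSequence_of_companion (h0 : q 0 = mu)
    (hstrip : ∀ i, IsHorizontalStrip (stage q i) (stage q (i + 1)))
    (htop : ∀ i, ∃ s, (stage q i).colLen 0 < s ∧ companion q s i = nu.rowLen i)
    (hle : ∀ s i, companion q (s + 1) (i + 1) ≤ companion q s i) : IsLRSequence mu nu q := by
  let m : ℕ → ℕ → ℕ := fun i t => companion q t (i - 1) - companion q (t - 1) (i - 1)
  have hm : ∀ i t, m (i + 1) (t + 1) = (stage q (i + 1)).rowLen t - (stage q i).rowLen t :=
    fun i t => by simp only [m, Nat.add_sub_cancel, companion_succ, Nat.add_sub_cancel_left]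
  have hk : ∀ i s, k m (i + 1) s = companion q s i := fun i s => by
    simp only [k_eq_sum_range, hm, companion]
  refine ⟨h0, m, fun i => ?_, fun i j hi _ hj => ?_⟩
  · obtain ⟨s, hs, hsum⟩ := htop i
    rw [r_succ, ← stage_val (q := q), ← stage_val (q := q)]
    refine (isStep_iff hs).mpr ⟨hstrip i, Nat.sub_self _, fun a => ?_, ?_⟩
    · rw [hm]
      exact (Nat.add_sub_of_le (hstrip i a).1).symm
    · rw [← k_eq_sum_range, hk, hsum]
  · obtain ⟨i, rfl⟩ := Nat.exists_eq_add_of_le' hi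
    obtain ⟨j, rfl⟩ := Nat.exists_eq_add_of_le' hj
    exact (hk (i + 1) (j + 1)).trans_le ((hle j i).trans_eq (hk i j).symm)

theorem exists_rowLen_eq {f : ℕ → ℕ} {n : ℕ} (hf : Antitone f) (h0 : f n = 0) :
    ∃ lam : YoungDiagram, lam.rowLen = f := by
  have hmem : ∀ p : ℕ × ℕ, p ∈ {p ∈ range n ×ˢ range (f 0) | p.2 < f p.1} ↔ p.2 < f p.1 :=
    fun p => by
      simp only [mem_filter, mem_product, mem_range, and_iff_right_iff_imp]
      refine fun hp => ⟨?_, hp.trans_le (hf (Nat.zero_le _))⟩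
      by_contra! hn
      have := hf hn
      omega
  let lam : YoungDiagram :=
    { cells := {p ∈ range n ×ˢ range (f 0) | p.2 < f p.1}
      isLowerSet := fun a b hab ha => (hmem b).mpr
        (hab.2.trans_lt (((hmem a).mp ha).trans_le (hf hab.1))) }
  exact ⟨lam, funext fun i => eq_of_forall_lt_iff fun j =>
    YoungDiagram.mem_iff_lt_rowLen.symm.trans (hmem (i, j))⟩

variable {n : ℕ} {g : ℕ → ℕ → ℕ}

theorem IsDominant.antitone_add_weight (hd : IsDominant mu.rowLen g) (i : ℕ) :
    Antitone (mu.rowLen + weight g i) :=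
  antitone_nat_of_succ_le fun t => by
    have := hd i t
    rw [FailsAt, weight_succ] at this
    simp only [Pi.add_apply]
    omega

theorem companion_eq_of_rowLen_stage (hg : IsGTPattern n nu.rowLen g)
    (hrow : ∀ i, (stage q i).rowLen = mu.rowLen + weight g i) : companion q = g := by
  funext s i
  have hdiff : ∀ t, (stage q (i + 1)).rowLen t - (stage q i).rowLen t = g (t + 1) i - g t i :=
    fun t => by
      simp only [hrow, Pi.add_apply, weight_succ]
      omega
  simp only [companion, hdiff]
  rw [sum_range_tsub (f := fun t => g t i) (hg.monotone i), hg.zero, Nat.sub_zero]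

theorem exists_companion_eq (hg : IsGTPattern n nu.rowLen g) (hd : IsDominant mu.rowLen g)
    (hn : mu.colLen 0 ≤ n) :
    ∃ q : Fin (u nu 1 + 1) → YoungDiagram, IsLRSequence mu nu q ∧ companion q = g := by
  have hzero : ∀ i, (mu.rowLen + weight g i) n = 0 := fun i => by
    rw [Pi.add_apply, rowLen_eq_zero_iff.mpr hn, hg.weight_eq_zero i le_rfl]
  choose lam hlam using fun i => exists_rowLen_eq (hd.antitone_add_weight i) (hzero i)
  let q : Fin (u nu 1 + 1) → YoungDiagram := fun i => lam i
  have hrow : ∀ i, (stage q i).rowLen = mu.rowLen + weight g i := fun i => by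
    obtain hi | hi := le_total i (u nu 1)
    · rw [stage, hlam, Fin.coe_clamp, min_eq_left hi]
    · rw [stage_of_le hi, hlam, Fin.val_last]
      refine congrArg _ (funext fun t => sum_subset (range_mono hi) fun j _ hj => ?_)
      have hz := fun s => Nat.le_zero.mp
        (rowLen_eq_zero_of_u_le (not_lt.mp (mem_range.not.mp hj)) ▸ hg.le_top s j)
      rw [hz, hz, Nat.sub_self]
  have hcomp := companion_eq_of_rowLen_stage hg hrow
  refine ⟨q, isLRSequence_of_companion ?_ (fun i a => ⟨?_, ?_⟩) (fun i => ?_) ?_, hcomp⟩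
  · exact rowLen_injective (hlam 0)
  · rw [hrow, hrow, Pi.add_apply, Pi.add_apply, weight_succ]
    omega
  · rw [hrow, hrow]
    exact not_lt.mp (hd i a)
  · exact ⟨max n ((stage q i).colLen 0 + 1), by omega, hcomp ▸ hg.eq_top _ (le_max_left _ _) i⟩
  · exact hcomp ▸ hg.succ_succ_le

end LRSequence

theorem schurPoly_mul_schurPoly {mu nu : YoungDiagram} {n : ℕ}
    (hn : mu.colLen 0 + nu.colLen 0 ≤ n) :
    schurPoly ℂ n mu.rowLen * schurPoly ℂ n nu.rowLen =
      ∑ q ∈ (finite_setOf_isLRSequence mu nu).toFinset,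
        schurPoly ℂ n (q (Fin.last (u nu 1))).rowLen := by
  classical
  have hmem : ∀ q, q ∈ (finite_setOf_isLRSequence mu nu).toFinset ↔ IsLRSequence mu nu q :=
    fun q => Set.Finite.mem_toFinset _
  have hu : u nu 1 ≤ n := by rw [u_succ]; omega
  refine mul_right_cancel₀ (b := shiftedAlternant ℂ n 0) ?_ ?_
  · exact alternant_ne_zero (strictAnti_add_rho antitone_const)
  rw [mul_right_comm,
    schurPoly_mul_shiftedAlternant_zero (antitone_rowLen mu) (rowLen_eq_zero_iff.mpr (by omega)),
    mul_comm, schurPoly_mul_shiftedAlternant (antitone_rowLen mu), sum_mul]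
  refine (sum_nbij companion (fun q hq => ?_) (fun q hq q' hq' => ?_) (fun g hg => ?_)
    fun q hq => ?_).symm
  · have h := (hmem q).mp hq
    exact mem_filter.mpr ⟨mem_gtPatterns.mpr (h.isGTPattern_companion hn), h.isDominant_companion⟩
  · exact companion_injOn ((hmem q).mp hq) ((hmem q').mp hq')
  · obtain ⟨hg, hd⟩ := mem_filter.mp hg
    obtain ⟨q, hq, rfl⟩ := exists_companion_eq (mem_gtPatterns.mp hg) hd (by omega)
    exact ⟨q, (hmem q).mpr hq, rfl⟩
  · have h := (hmem q).mp hq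
    have hzero : (mu.rowLen + weight (companion q) n) n = 0 := by
      rw [Pi.add_apply, rowLen_eq_zero_iff.mpr (by omega),
        (h.isGTPattern_companion hn).weight_eq_zero n le_rfl]
    have hlast : (q (Fin.last (u nu 1))).rowLen = mu.rowLen + weight (companion q) n := by
      rw [← h.rowLen_stage, stage_of_le hu]
    rw [hlast, schurPoly_mul_shiftedAlternant_zero (hlast ▸ antitone_rowLen _) hzero]

theorem schur_mul_schur (mu nu : YoungDiagram) :
    schur mu * schur nu = ∑ q ∈ (finite_setOf_isLRSequence mu nu).toFinset,
      schur (q (Fin.last (u nu 1))) :=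
  eq_of_killCompl_eq (mu.colLen 0 + nu.colLen 0) fun n hn => by
    simp only [map_mul, map_sum, killCompl_schur]
    rw [← MvPolynomial.coe_mul, schurPoly_mul_schurPoly hn]
    exact map_sum (MvPolynomial.coeToMvPowerSeries.ringHom) _ _

theorem isSchurExpansion_sum_single (mu nu : YoungDiagram) :
    IsSchurExpansion (schur mu * schur nu)
      (∑ q ∈ (finite_setOf_isLRSequence mu nu).toFinset,
        Finsupp.single (q (Fin.last (u nu 1))) 1) := by
  change _ = Finsupp.linearCombination ℂ schur _
  rw [map_sum, schur_mul_schur]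
  exact sum_congr rfl fun q _ => by rw [Finsupp.linearCombination_single, one_smul]

theorem IsSchurExpansion.unique {f : MvPowerSeries ℕ ℂ} {c c' : YoungDiagram →₀ ℂ}
    (h : IsSchurExpansion f c) (h' : IsSchurExpansion f c') : c = c' :=
  linearIndependent_schur (h.symm.trans h')

end CodeLR

theorem theorem5 (mu nu : YoungDiagram) :
    (∃! c : YoungDiagram →₀ ℂ, IsSchurExpansion (schur mu * schur nu) c) ∧
    (∃ hfin : {q : Fin (u nu 1 + 1) → YoungDiagram | IsLRSequence mu nu q}.Finite,
      schur mu * schur nu = ∑ q ∈ hfin.toFinset, schur (q (Fin.last (u nu 1)))) ∧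
    (∀ c : YoungDiagram →₀ ℂ, IsSchurExpansion (schur mu * schur nu) c →
      ∀ lam : YoungDiagram, c lam =
        (Nat.card {q : Fin (u nu 1 + 1) → YoungDiagram //
          IsLRSequence mu nu q ∧ q (Fin.last (u nu 1)) = lam} : ℂ)) := by
  classical
  have hex := isSchurExpansion_sum_single mu nu
  refine ⟨⟨_, hex, fun c hc => hc.unique hex⟩,
    ⟨finite_setOf_isLRSequence mu nu, schur_mul_schur mu nu⟩, fun c hc lam => ?_⟩
  rw [hc.unique hex, Finsupp.finsetSum_apply]
  simp only [Finsupp.single_apply]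
  rw [← Finset.natCast_card_filter]
  congr 1
  symm
  refine Nat.subtype_card _ fun q => ?_
  simp
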